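/- Let $m,d,p\in\mathbb{N}=\{1,2,\ldots\}$ and $q\in\mathbb{N}_0$, and let all random vectors be defined on one probability space. A $\mathbb{C}^r$-valued process $(X_t)_{t\in\mathbb{Z}}$ is called weakly stationary if each $X_t$ has finite second moment and if $\mathbb{E}X_t$ and $\mathrm{Cov}(X_t,X_{t+h})=\mathbb{E}\big[(X_t-\mathbb{E}X_t)(X_{t+h}-\mathbb{E}X_{t+h})^*\big]$ do not depend on $t\in\mathbb{Z}$, for each $h\in\mathbb{Z}$; it is called weak white noise if, in addition, $\mathrm{Cov}(X_t,X_{t'})=0$ for $t\neq t'$. Let $(Z_t)_{t\in\mathbb{Z}}$ be weak white noise in $\mathbb{C}^d$ with covariance matrix $\Sigma=\mathrm{Cov}(Z_0,Z_0)$. Let $\Psi_1,\ldots,\Psi_p\in\mathbb{C}^{m\times m}$ and $\Theta_0,\ldots,\Theta_q\in\mathbb{C}^{m\times d}$, and put $$P(z)=\mathrm{Id}_m-\sum_{k=1}^p\Psi_kz^k,\qquad Q(z)=\sum_{k=0}^q\Theta_kz^k,\qquad z\in\mathbb{C}.$$ There are $s\in\{0,\ldots,d\}$, a real $s\times s$ diagonal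 matrix $D$ with strictly positive diagonal entries, and a unitary matrix $U\in\mathbb{C}^{d\times d}$ such that $$U\Sigma U^*=\begin{pmatrix}D&0\\0&0\end{pmatrix}.$$ Let $s,D,U$ be any such choice. Then the ARMA$(p,q)$ equation $$Y_t-\Psi_1Y_{t-1}-\cdots-\Psi_pY_{t-p}=\Theta_0Z_t+\cdots+\Theta_qZ_{t-q}\quad\text{for all }t\in\mathbb{Z},\text{ almost surely},$$ admits a weakly stationary solution $(Y_t)_{t\in\mathbb{Z}}$ with values in $\mathbb{C}^m$ if and only if (a) the rational matrix function $$M(z)=P^{-1}(z)\,Q(z)\,U^*\begin{pmatrix}\mathrm{Id}_s&0\\0&0\end{pmatrix}$$ has only removable singularities on the unit circle $\{|z|=1\}$, and (b) there is some $g\in\mathbb{C}^m$ with $P(1)\,g=Q(1)\,\mathbb{E}Z_0$. In that case, $M$ has a Laurent expansion $M(z)=\sum_{j=-\infty}^\infty M_jz^j$ which converges absolutely in a neighbourhood of the unit circle, and for every $g$ as in (b), $$Y_t=g+\sum_{j=-\infty}^\infty M_j\,U\,(Z_{t-j}-\mathbb{E}Z_0),\qquad t\in\mathbb{Z},$$ where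 the series converges absolutely almost surely, is a weakly stationary solution of the ARMA$(p,q)$ equation. -/

import Mathlib

open MeasureTheory Filter Topology Matrix

namespace WeakARMA

/-- The covariance matrix `E[(X - E X) (Y - E Y)^*]` of two complex random vectors. -/
noncomputable def covMatrix {Ω : Type*} [MeasurableSpace Ω] (μ : Measure Ω) {r k : ℕ}
    (X : Ω → Fin r → ℂ) (Y : Ω → Fin k → ℂ) : Matrix (Fin r) (Fin k) ℂ :=
  Matrix.of fun i j =>
    ∫ ω, (X ω i - ∫ ω', X ω' i ∂μ) * star (Y ω j - ∫ ω', Y ω' j ∂μ) ∂μ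

/-- Weak stationarity: finite second moments, and mean and covariances do not depend on time. -/
structure IsWeaklyStationary {Ω : Type*} [MeasurableSpace Ω] (μ : Measure Ω) {r : ℕ}
    (X : ℤ → Ω → Fin r → ℂ) : Prop where
  memLp : ∀ t, MemLp (X t) 2 μ
  mean_eq : ∀ t t', ∫ ω, X t ω ∂μ = ∫ ω, X t' ω ∂μ
  cov_eq : ∀ h t t', covMatrix μ (X t) (X (t + h)) = covMatrix μ (X t') (X (t' + h))

/-- Weak white noise: weakly stationary, and the components at different times
are uncorrelated. -/
structure IsWeakWhiteNoise {Ω : Type*} [MeasurableSpace Ω] (μ : Measure Ω) {r : ℕ}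
    (X : ℤ → Ω → Fin r → ℂ) : Prop extends IsWeaklyStationary μ X where
  uncorrelated : ∀ t t', t ≠ t' → covMatrix μ (X t) (X t') = 0

/-- The autoregressive polynomial `P(z) = Id - ∑_{k=1}^p Ψ_k z^k`;
the matrix `Ψ_k` is stored at index `k - 1`. -/
def arPoly {m p : ℕ} (Ψ : Fin p → Matrix (Fin m) (Fin m) ℂ) (z : ℂ) :
    Matrix (Fin m) (Fin m) ℂ :=
  1 - ∑ k : Fin p, z ^ (k.val + 1) • Ψ k

/-- The moving average polynomial `Q(z) = ∑_{k=0}^q Θ_k z^k`. -/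
def maPoly {m d q : ℕ} (Θ : Fin (q + 1) → Matrix (Fin m) (Fin d) ℂ) (z : ℂ) :
    Matrix (Fin m) (Fin d) ℂ :=
  ∑ k : Fin (q + 1), z ^ k.val • Θ k

/-- `Y` solves the ARMA equation
`Y_t - ∑_{k=1}^p Ψ_k Y_{t-k} = ∑_{k=0}^q Θ_k Z_{t-k}`, `t ∈ ℤ`, almost surely. -/
def IsARMASolution {Ω : Type*} [MeasurableSpace Ω] (μ : Measure Ω) {m d p q : ℕ}
    (Ψ : Fin p → Matrix (Fin m) (Fin m) ℂ) (Θ : Fin (q + 1) → Matrix (Fin m) (Fin d) ℂ)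
    (Z : ℤ → Ω → Fin d → ℂ) (Y : ℤ → Ω → Fin m → ℂ) : Prop :=
  ∀ᵐ ω ∂μ, ∀ t : ℤ,
    Y t ω - ∑ k : Fin p, Ψ k *ᵥ Y (t - ((k.val : ℤ) + 1)) ω
      = ∑ k : Fin (q + 1), Θ k *ᵥ Z (t - (k.val : ℤ)) ω

/-- The `d × d` block matrix with the diagonal matrix of `v` as upper left `s × s` block
and zeros elsewhere. -/
def padDiag (d : ℕ) {s : ℕ} (v : Fin s → ℂ) : Matrix (Fin d) (Fin d) ℂ :=
  Matrix.diagonal fun i => if h : i.val < s then v ⟨i.val, h⟩ else 0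

/-- `U` is unitary and `U S U^*` is the block matrix `diag(D, 0)`, with `D` a real diagonal
`s × s` matrix with strictly positive diagonal. -/
structure IsUnitaryDiagonalization {d : ℕ} (S : Matrix (Fin d) (Fin d) ℂ) (s : ℕ)
    (D : Fin s → ℝ) (U : Matrix (Fin d) (Fin d) ℂ) : Prop where
  le : s ≤ d
  unitary : U ∈ Matrix.unitaryGroup (Fin d) ℂ
  pos : ∀ i, 0 < D i
  diag : U * S * Uᴴ = padDiag d (fun i => (D i : ℂ))

/-- The rational matrix function `M(z) = P(z)⁻¹ Q(z) U^* diag(Id_s, 0)`. It is meaningful where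
`det P(z) ≠ 0`, that is, off a finite set, since `det P(0) = 1`. -/
noncomputable def transfer {m d p q : ℕ} (Ψ : Fin p → Matrix (Fin m) (Fin m) ℂ)
    (Θ : Fin (q + 1) → Matrix (Fin m) (Fin d) ℂ) (U : Matrix (Fin d) (Fin d) ℂ) (s : ℕ)
    (z : ℂ) : Matrix (Fin m) (Fin d) ℂ :=
  (arPoly Ψ z)⁻¹ * maPoly Θ z * Uᴴ * padDiag d (fun _ : Fin s => (1 : ℂ))

/-- Each entry of `F` has only removable singularities on the unit circle: near every point of
the circle it agrees, off the point itself, with a function that is holomorphic there. The values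
of `F` at the (isolated) singular points themselves are irrelevant. -/
def OnlyRemovableOnCircle {m d : ℕ} (F : ℂ → Matrix (Fin m) (Fin d) ℂ) : Prop :=
  ∀ z₀ : ℂ, ‖z₀‖ = 1 → ∀ i j, ∃ f : ℂ → ℂ,
    AnalyticAt ℂ f z₀ ∧ ∀ᶠ z in 𝓝[≠] z₀, F z i j = f z

/-- `∑_{n ∈ ℤ} c_n z^n` is the Laurent expansion of `M` in a neighbourhood of the unit circle:
it converges absolutely on an open annulus around the circle, and its sum there is `M(z)`
wherever `P(z)` is invertible. -/
def IsLaurentExpansion {m d p q : ℕ} (Ψ : Fin p → Matrix (Fin m) (Fin m) ℂ)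
    (Θ : Fin (q + 1) → Matrix (Fin m) (Fin d) ℂ) (U : Matrix (Fin d) (Fin d) ℂ) (s : ℕ)
    (c : ℤ → Matrix (Fin m) (Fin d) ℂ) : Prop :=
  ∃ r R : ℝ, 0 ≤ r ∧ r < 1 ∧ 1 < R ∧ ∀ z : ℂ, r < ‖z‖ → ‖z‖ < R →
    (∀ i j, Summable fun n : ℤ => ‖z ^ n * c n i j‖) ∧
    ((arPoly Ψ z).det ≠ 0 → HasSum (fun n : ℤ => z ^ n • c n) (transfer Ψ Θ U s z))

end WeakARMA

/-! Both directions work with the centred noise `N_t = U (Z_t - E Z_0)`: its components are mutually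
orthogonal white noises, and the last `d - s` vanish almost surely. Replacing `Θ_k` by `Θ'_k = Θ_k
U^* diag(Id_s, 0)` and driving the equation by `N` therefore leaves the centred right-hand side
unchanged almost surely, and `M = P⁻¹ Q'` for the new coefficients. Expectations of both sides give
(b) with `g = E Y_0`; conversely, `g` restores the mean.

Sufficiency: the entries of `M` are polynomials divided by `det P`. If the singularities on the
circle are removable, the numerators cancel all zeros of `det P` there, and the remaining linear
factors expand in geometric series on an annulus (`exists_hasLaurentOn_div`). Comparing coefficients
in `P M = Q'` gives a recursion (`IsLaurentExpansion.recursion`). The coefficients are absolutely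
summable, so filtering `N` by them gives a weakly stationary process, and the recursion says that it
solves the equation.

Necessity: in `L²`, with `B` the backward shift, multiplication by the adjugate of `P(B)` decouples
the system into scalar equations `det P(B) x = ∑ b_j(B) y_j`, with `x` bounded and the `y_j`
orthogonal white noises. At a zero `l` of `det P` on the circle this becomes `u_{t-1} - l u_t = ∑
b_j(l) y_{j,t}` with `u` bounded. Weighted by powers of `l`, the left side telescopes to something
bounded, while the right side is an orthogonal random walk of norm `√(n V)`; so `V = 0`, and `b_j(l)
= 0` for every nonzero noise. For multiple zeros one factor `B - l` is cancelled, which preserves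
the equation only up to a sequence in its kernel. Such a sequence adds a linear drift to the walk,
also excluded by boundedness (`eq_zero_of_bounded_drift_add_walk`), so induction on the multiplicity
closes. -/

namespace WeakARMA

/-! ### Laurent series on annuli around the unit circle -/

/-- On the annulus `r < ‖z‖ < R`, `f` is the sum of an absolutely convergent Laurent series. -/
def HasLaurentOn (r R : ℝ) (f : ℂ → ℂ) : Prop :=
  ∃ c : ℤ → ℂ, ∀ z : ℂ, r < ‖z‖ → ‖z‖ < R →
    (Summable fun n : ℤ => ‖z ^ n * c n‖) ∧ HasSum (fun n : ℤ => z ^ n * c n) (f z)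

lemma HasLaurentOn.mono {r R r' R' : ℝ} {f : ℂ → ℂ} (h : HasLaurentOn r R f) (hr : r ≤ r')
    (hR : R' ≤ R) : HasLaurentOn r' R' f := by
  obtain ⟨c, hc⟩ := h
  exact ⟨c, fun z h1 h2 => hc z (hr.trans_lt h1) (h2.trans_le hR)⟩

lemma HasLaurentOn.add {r R : ℝ} {f g : ℂ → ℂ} (hf : HasLaurentOn r R f)
    (hg : HasLaurentOn r R g) : HasLaurentOn r R (fun z => f z + g z) := by
  obtain ⟨c, hc⟩ := hf
  obtain ⟨d, hd⟩ := hg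
  refine ⟨fun n => c n + d n, fun z h1 h2 => ?_⟩
  have e : (fun n : ℤ => z ^ n * (c n + d n)) = fun n => z ^ n * c n + z ^ n * d n := by
    ext n; ring
  refine ⟨?_, ?_⟩
  · refine Summable.of_nonneg_of_le (fun _ => norm_nonneg _) (fun n => ?_)
      ((hc z h1 h2).1.add (hd z h1 h2).1)
    rw [mul_add]; exact norm_add_le _ _
  · rw [e]; exact (hc z h1 h2).2.add (hd z h1 h2).2

/-- The product family on `ℤ × ℤ` is absolutely summable; reindexed by `(n, k) ↦ (k, n - k)`, it is
summed over the fibres of fixed `n`. -/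
lemma hasSum_int_cauchyProduct {u v : ℤ → ℂ} (hu : Summable fun n => ‖u n‖)
    (hv : Summable fun n => ‖v n‖) :
    (Summable fun n : ℤ => ‖∑' k, u k * v (n - k)‖) ∧
      HasSum (fun n : ℤ => ∑' k, u k * v (n - k)) ((∑' n, u n) * ∑' n, v n) := by
  let e : ℤ × ℤ ≃ ℤ × ℤ :=
    { toFun := fun x => (x.2, x.1 - x.2)
      invFun := fun x => (x.1 + x.2, x.1)
      left_inv := fun x => by ext <;> simp
      right_inv := fun x => by ext <;> simp }
  have hn : Summable fun x : ℤ × ℤ => ‖u x.2 * v (x.1 - x.2)‖ :=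
    (e.summable_iff (f := fun x : ℤ × ℤ => ‖u x.1 * v x.2‖)).2 (hu.mul_norm hv)
  have hs : HasSum (fun x : ℤ × ℤ => u x.2 * v (x.1 - x.2)) ((∑' n, u n) * ∑' n, v n) := by
    refine (e.hasSum_iff (f := fun x : ℤ × ℤ => u x.1 * v x.2)).2 ?_
    exact hu.of_norm.hasSum.mul hv.of_norm.hasSum (hu.mul_norm hv).of_norm
  constructor
  · refine Summable.of_nonneg_of_le (fun _ => norm_nonneg _) (fun n => ?_) hn.prod
    exact norm_tsum_le_tsum_norm (hn.prod_factor n)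
  · exact hs.prod_fiberwise fun n => (hn.prod_factor n).of_norm.hasSum

lemma HasLaurentOn.mul {r R : ℝ} (hr : 0 ≤ r) {f g : ℂ → ℂ} (hf : HasLaurentOn r R f)
    (hg : HasLaurentOn r R g) : HasLaurentOn r R (fun z => f z * g z) := by
  obtain ⟨c, hc⟩ := hf
  obtain ⟨d, hd⟩ := hg
  refine ⟨fun n => ∑' k, c k * d (n - k), fun z h1 h2 => ?_⟩
  have hz : z ≠ 0 := norm_pos_iff.1 (hr.trans_lt h1)
  have e : (fun n : ℤ => z ^ n * ∑' k, c k * d (n - k)) =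
      fun n => ∑' k, (z ^ k * c k) * (z ^ (n - k) * d (n - k)) := by
    ext n
    rw [← tsum_mul_left]
    refine tsum_congr fun k => ?_
    rw [zpow_sub₀ hz]
    field_simp
  have := hasSum_int_cauchyProduct (hc z h1 h2).1 (hd z h1 h2).1
  rw [(hc z h1 h2).2.tsum_eq, (hd z h1 h2).2.tsum_eq] at this
  refine ⟨?_, ?_⟩
  · convert this.1 using 2 with n
    exact congrArg norm (congrFun e n)
  · rw [e]; exact this.2

lemma hasLaurentOn_const_mul_pow (r R : ℝ) (a : ℂ) (k : ℕ) :
    HasLaurentOn r R (fun z => a * z ^ k) := by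
  refine ⟨fun n => if n = k then a else 0, fun z h1 h2 => ⟨?_, ?_⟩⟩
  · refine summable_of_ne_finset_zero (s := {(k : ℤ)}) fun n hn => ?_
    simp only [Finset.mem_singleton] at hn
    simp [hn]
  · convert hasSum_ite_eq (k : ℤ) (a * z ^ k) using 2 with n
    by_cases h : n = k
    · simp [h, mul_comm]
    · simp [h]

lemma hasLaurentOn_polynomial (r R : ℝ) (p : Polynomial ℂ) :
    HasLaurentOn r R (fun z => p.eval z) := by
  induction p using Polynomial.induction_on' with
  | add p q hp hq => simpa using hp.add hq
  | monomial n a => simpa using hasLaurentOn_const_mul_pow r R a n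

lemma hasSum_int_of_nat {E : Type*} [NormedAddCommGroup E] {f : ℤ → E} {a : E} {e : ℕ → ℤ}
    (he : Function.Injective e) (hf : ∀ n, n ∉ Set.range e → f n = 0)
    (hs : Summable fun n => ‖f (e n)‖) (h : HasSum (fun n => f (e n)) a) :
    (Summable fun n => ‖f n‖) ∧ HasSum f a := by
  refine ⟨?_, (he.hasSum_iff hf).1 h⟩
  exact (he.summable_iff (f := fun n => ‖f n‖) fun n hn => by simp [hf n hn]).1 hs

/-- Outside the disc of radius `‖ρ‖` the geometric series in `ρ / z` applies, so `z ^ (-n - 1)` has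
coefficient `ρ ^ n`. -/
lemma hasLaurentOn_inv_sub_of_norm_le {r R : ℝ} {ρ : ℂ} (h : ‖ρ‖ ≤ r) :
    HasLaurentOn r R (fun z => (z - ρ)⁻¹) := by
  refine ⟨fun n => if n < 0 then ρ ^ (-n - 1).toNat else 0, fun z h1 h2 => ?_⟩
  have hz : z ≠ 0 := norm_pos_iff.1 (((norm_nonneg ρ).trans h).trans_lt h1)
  have hlt : ‖ρ / z‖ < 1 := by
    rw [norm_div, div_lt_one (norm_pos_iff.2 hz)]; exact h.trans_lt h1
  have key : ∀ n : ℕ, z ^ (-(n : ℤ) - 1) *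
      (if (-(n : ℤ) - 1) < 0 then ρ ^ (-(-(n : ℤ) - 1) - 1).toNat else 0) =
      z⁻¹ * (ρ / z) ^ n := by
    intro n
    rw [if_pos (by omega), show (-(-(n : ℤ) - 1) - 1).toNat = n by omega,
      show (-(n : ℤ) - 1) = -((n + 1 : ℕ) : ℤ) by push_cast; ring, _root_.zpow_neg, zpow_natCast, div_pow, pow_succ]
    field_simp
  refine hasSum_int_of_nat (e := fun n : ℕ => -(n : ℤ) - 1) (fun a b hab => by
    simpa using hab) (fun n hn => ?_) ?_ ?_
  · dsimp only
    rw [if_neg, mul_zero]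
    intro h'
    exact hn ⟨(-n - 1).toNat, by simp only; omega⟩
  · simp only [key, norm_mul, norm_pow]
    exact (summable_geometric_of_lt_one (norm_nonneg _) hlt).mul_left _
  · simp only [key]
    have hne : z - ρ ≠ 0 := by
      intro h0; rw [sub_eq_zero] at h0; subst h0; linarith
    have := (hasSum_geometric_of_norm_lt_one hlt).mul_left z⁻¹
    rwa [← mul_inv, mul_sub, mul_one, mul_div_cancel₀ _ hz] at this

/-- Inside the disc of radius `‖ρ‖` the expansion is the geometric series in `z / ρ`. -/
lemma hasLaurentOn_inv_sub_of_le_norm {r R : ℝ} (hR : 0 < R) {ρ : ℂ} (h : R ≤ ‖ρ‖) :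
    HasLaurentOn r R (fun z => (z - ρ)⁻¹) := by
  refine ⟨fun n => if 0 ≤ n then -ρ⁻¹ * ρ⁻¹ ^ n.toNat else 0, fun z h1 h2 => ?_⟩
  have hρ : ρ ≠ 0 := norm_pos_iff.1 (hR.trans_le h)
  have hlt : ‖z / ρ‖ < 1 := by
    rw [norm_div, div_lt_one (norm_pos_iff.2 hρ)]; exact h2.trans_le h
  have key : ∀ n : ℕ, z ^ (n : ℤ) *
      (if 0 ≤ (n : ℤ) then -ρ⁻¹ * ρ⁻¹ ^ (n : ℤ).toNat else 0) = -ρ⁻¹ * (z / ρ) ^ n := by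
    intro n
    rw [if_pos (by omega), Int.toNat_natCast, zpow_natCast, div_pow, inv_pow]
    ring
  refine hasSum_int_of_nat (e := fun n : ℕ => (n : ℤ)) Nat.cast_injective (fun n hn => ?_) ?_ ?_
  · dsimp only
    rw [if_neg, mul_zero]
    intro h'
    exact hn ⟨n.toNat, by simp only; omega⟩
  · simp only [key, norm_mul, norm_pow]
    exact (summable_geometric_of_lt_one (norm_nonneg _) hlt).mul_left _
  · simp only [key]
    have := (hasSum_geometric_of_norm_lt_one hlt).mul_left (-ρ⁻¹)
    have e : -ρ⁻¹ * (1 - z / ρ)⁻¹ = (z - ρ)⁻¹ := by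
      rw [← inv_neg, ← mul_inv]; congr 1; field_simp; ring
    rwa [e] at this

/-- The reciprocal of a product of linear factors without zeros on the unit circle has a Laurent
expansion on an annulus around the circle. -/
lemma exists_hasLaurentOn_inv_prod (s : Multiset ℂ) (hs : ∀ ρ ∈ s, ‖ρ‖ ≠ 1) :
    ∃ r R : ℝ, 0 ≤ r ∧ r < 1 ∧ 1 < R ∧ (∀ ρ ∈ s, ‖ρ‖ ≤ r ∨ R ≤ ‖ρ‖) ∧
      HasLaurentOn r R (fun z => ((s.map fun ρ => z - ρ).prod)⁻¹) := by
  induction s using Multiset.induction_on with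
  | empty =>
    refine ⟨0, 2, le_rfl, one_pos, one_lt_two, by simp, ?_⟩
    simpa using hasLaurentOn_const_mul_pow 0 2 1 0
  | cons ρ s ih =>
    obtain ⟨r, R, h0, hr, hR, hs', hL⟩ := ih fun x hx => hs x (Multiset.mem_cons_of_mem hx)
    simp only [Multiset.map_cons, Multiset.prod_cons, mul_inv, Multiset.mem_cons, forall_eq_or_imp]
    -- A root inside the circle may raise the inner radius, one outside may lower the outer radius.
    rcases lt_or_gt_of_ne (hs ρ (Multiset.mem_cons_self _ _)) with h | h
    · refine ⟨max r ‖ρ‖, R, h0.trans (le_max_left _ _), max_lt hr h, hR,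
        ⟨Or.inl (le_max_right _ _), fun x hx => ?_⟩, ?_⟩
      · exact (hs' x hx).imp_left fun h => h.trans (le_max_left _ _)
      · exact (hasLaurentOn_inv_sub_of_norm_le (le_max_right _ _)).mul
          (h0.trans (le_max_left _ _)) (hL.mono (le_max_left _ _) le_rfl)
    · refine ⟨r, min R ‖ρ‖, h0, hr, lt_min hR h,
        ⟨Or.inr (min_le_right _ _), fun x hx => ?_⟩, ?_⟩
      · exact (hs' x hx).imp_right fun h => (min_le_left _ _).trans h
      · exact (hasLaurentOn_inv_sub_of_le_norm (lt_min (by linarith) (by linarith))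
          (min_le_right _ _)).mul h0 (hL.mono le_rfl (min_le_left _ _))

/-- Uniqueness of Laurent coefficients on the unit circle. -/
lemma laurent_coeff_eq_zero {d : ℤ → ℂ} (hd : Summable fun n => ‖d n‖) {S : Set ℂ}
    (hS : S.Finite) (h : ∀ z : ℂ, ‖z‖ = 1 → z ∉ S → HasSum (fun n : ℤ => z ^ n * d n) 0)
    (k : ℤ) : d k = 0 := by
  have hn : Summable fun n => ‖d n • (fourier n : C(UnitAddCircle, ℂ))‖ := by
    refine hd.congr fun n => ?_
    rw [norm_smul, fourier_norm, mul_one]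
  have hsum : HasSum (fun n => d n • (fourier n : C(UnitAddCircle, ℂ)))
      (∑' n, d n • (fourier n : C(UnitAddCircle, ℂ))) := hn.of_norm.hasSum
  -- The series converges uniformly on the circle, so its sum is continuous; it vanishes off a
  -- finite set, hence on a dense set.
  have hzero : (∑' n, d n • (fourier n : C(UnitAddCircle, ℂ))) = 0 := by
    have hfin : {x : UnitAddCircle | ((AddCircle.toCircle x : Circle) : ℂ) ∈ S}.Finite :=
      hS.preimage (Subtype.coe_injective.comp
        (AddCircle.injective_toCircle one_ne_zero)).injOn
    have : Nontrivial UnitAddCircle := by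
      refine nontrivial_of_ne ((1 / 2 : ℝ) : UnitAddCircle) 0 fun h0 => ?_
      obtain ⟨n, hn⟩ := (AddCircle.coe_eq_zero_iff (1 : ℝ)).1 h0
      have h2 : ((2 * n : ℤ) : ℝ) = (1 : ℤ) := by
        push_cast; rw [zsmul_eq_mul, mul_one] at hn; linarith
      have h3 : 2 * n = 1 := Int.cast_injective h2
      omega
    have hdense : Dense {x : UnitAddCircle | ((AddCircle.toCircle x : Circle) : ℂ) ∈ S}ᶜ := by
      simpa [Set.compl_eq_univ_sdiff] using dense_univ.sdiff_finite hfin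
    refine ContinuousMap.coe_injective (Continuous.ext_on hdense (ContinuousMap.continuous _)
      (ContinuousMap.continuous _) fun x hx => ?_)
    have h1 := hsum.mapL (ContinuousMap.evalCLM ℂ x)
    have h2 := h _ (Circle.norm_coe _) hx
    refine h1.unique (h2.congr_fun fun n => ?_)
    simp [fourier_apply, AddCircle.toCircle_zsmul, mul_comm]
  rw [hzero] at hsum
  -- Pairing with the `k`-th Fourier mode in `L²` isolates `d k`.
  have h3 := hsum.mapL ((innerSL ℂ (fourierLp (T := 1) 2 k)).comp
    (ContinuousMap.toLp (E := ℂ) 2 AddCircle.haarAddCircle ℂ))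
  have h4 := orthonormal_iff_ite.1 (orthonormal_fourier (T := 1))
  simp only [ContinuousLinearMap.comp_apply, map_smul, innerSL_apply_apply, h4, map_zero] at h3
  have h5 : HasSum (fun n => if n = k then d k else 0) (0 : ℂ) := by
    refine h3.congr_fun fun n => ?_
    by_cases hnk : n = k
    · simp [hnk]
    · simp [hnk, Ne.symm hnk]
  exact (hasSum_ite_eq k (d k)).unique h5

/-! ### Removable singularities of quotients of polynomials -/

open Polynomial in
/-- If `b / a` has a removable singularity at `l`, then `b` vanishes at `l` to at least the order
of `a`. -/
lemma X_sub_C_pow_dvd_of_removable {a b : Polynomial ℂ} (ha : a ≠ 0) {l : ℂ} {f : ℂ → ℂ}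
    (hf : ContinuousAt f l) (h : ∀ᶠ z in 𝓝[≠] l, b.eval z / a.eval z = f z) {n : ℕ}
    (hn : (X - C l) ^ n ∣ a) : (X - C l) ^ n ∣ b := by
  rcases eq_or_ne b 0 with rfl | hb
  · simp
  obtain ⟨b₁, hb₁, hndvd⟩ := exists_eq_pow_rootMultiplicity_mul_and_not_dvd b hb l
  by_cases hk : n ≤ rootMultiplicity l b
  · rw [hb₁]; exact (pow_dvd_pow _ hk).mul_right _
  exfalso
  obtain ⟨j, hj⟩ := Nat.exists_eq_add_of_lt (not_le.1 hk)
  obtain ⟨a₁, rfl⟩ := hn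
  refine hndvd (dvd_iff_isRoot.2 ?_)
  have hroots : ∀ᶠ z in 𝓝[≠] l, ((X - C l) ^ n * a₁).eval z ≠ 0 := by
    have hmem : ((((X - C l) ^ n * a₁).roots.toFinset.erase l : Finset ℂ) : Set ℂ)ᶜ ∈ 𝓝 l :=
      (Finset.finite_toSet _).isClosed.isOpen_compl.mem_nhds (by simp)
    filter_upwards [mem_nhdsWithin_of_mem_nhds hmem, self_mem_nhdsWithin] with z hz hzl h0
    refine hz ?_
    simp only [Finset.coe_erase, Set.mem_sdiff, Finset.mem_coe, Multiset.mem_toFinset,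
      Set.mem_singleton_iff]
    exact ⟨(mem_roots ha).2 h0, hzl⟩
  -- If `b` vanishes to order `n - (j + 1)` only, dividing by that power leaves a factor `(z - l) ^
  -- (j + 1)`. Letting `z → l` forces `b₁` to vanish at `l`, against maximality of the order.
  have heq : ∀ᶠ z in 𝓝[≠] l, b₁.eval z = (z - l) ^ (j + 1) * a₁.eval z * f z := by
    filter_upwards [h, hroots, self_mem_nhdsWithin] with z hz hr hzl
    have hzl' : z - l ≠ 0 := sub_ne_zero.2 hzl
    rw [div_eq_iff hr] at hz
    have h2 : b.eval z = (z - l) ^ rootMultiplicity l b * b₁.eval z := by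
      conv_lhs => rw [hb₁]
      simp
    rw [h2, hj] at hz
    simp only [eval_mul, eval_pow, eval_sub, eval_X, eval_C] at hz
    refine mul_left_cancel₀ (pow_ne_zero (rootMultiplicity l b) hzl') (hz.trans ?_)
    ring
  have h1 : Tendsto (fun z => b₁.eval z) (𝓝[≠] l) (𝓝 (b₁.eval l)) :=
    b₁.continuous.continuousAt.tendsto.mono_left nhdsWithin_le_nhds
  have h2 : Tendsto (fun z => (z - l) ^ (j + 1) * a₁.eval z * f z) (𝓝[≠] l)
      (𝓝 ((l - l) ^ (j + 1) * a₁.eval l * f l)) := by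
    refine Tendsto.mono_left ?_ nhdsWithin_le_nhds
    exact (((continuous_id.sub continuous_const).pow _).mul
      a₁.continuous).continuousAt.tendsto.mul hf.tendsto
  have h3 := tendsto_nhds_unique (h1.congr' heq) h2
  simpa using h3

open Polynomial in
-- The full power of `X - l` in `a` cancels against `b`, leaving a denominator that is nonzero at
-- `l`.
lemma exists_analyticAt_of_X_sub_C_pow_dvd {a b : Polynomial ℂ} (ha : a ≠ 0) {l : ℂ}
    (h : ∀ n : ℕ, (X - C l) ^ n ∣ a → (X - C l) ^ n ∣ b) :
    ∃ f : ℂ → ℂ, AnalyticAt ℂ f l ∧ ∀ᶠ z in 𝓝[≠] l, b.eval z / a.eval z = f z := by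
  obtain ⟨a₁, ha₁, hndvd⟩ := exists_eq_pow_rootMultiplicity_mul_and_not_dvd a ha l
  obtain ⟨b₁, hb₁⟩ := h (rootMultiplicity l a) (Dvd.intro _ ha₁.symm)
  have hne : a₁.eval l ≠ 0 := fun h0 => hndvd (dvd_iff_isRoot.2 h0)
  refine ⟨fun z => b₁.eval z / a₁.eval z, ?_, ?_⟩
  · exact (AnalyticOnNhd.eval_polynomial b₁ l trivial).div
      (AnalyticOnNhd.eval_polynomial a₁ l trivial) hne
  · filter_upwards [self_mem_nhdsWithin] with z hz
    have hz' : (z - l) ^ rootMultiplicity l a ≠ 0 := pow_ne_zero _ (sub_ne_zero.2 hz)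
    have h1 : a.eval z = (z - l) ^ rootMultiplicity l a * a₁.eval z := by
      conv_lhs => rw [ha₁]
      simp
    rw [h1, hb₁]
    simp only [eval_mul, eval_pow, eval_sub, eval_X, eval_C]
    exact mul_div_mul_left _ _ hz'

open Polynomial in
/-- A rational function without poles on the unit circle has a Laurent expansion on an annulus
that depends on the denominator only. -/
lemma exists_hasLaurentOn_div (a : Polynomial ℂ) :
    ∃ r R : ℝ, 0 ≤ r ∧ r < 1 ∧ 1 < R ∧ ∀ b : Polynomial ℂ,
      (∀ l : ℂ, ‖l‖ = 1 → ∀ n : ℕ, (X - C l) ^ n ∣ a → (X - C l) ^ n ∣ b) →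
      ∃ f, HasLaurentOn r R f ∧ ∀ z, a.eval z ≠ 0 → b.eval z / a.eval z = f z := by
  set s := a.roots.filter fun ρ => ‖ρ‖ = 1 with hs
  set t := a.roots.filter fun ρ => ¬ ‖ρ‖ = 1 with ht
  obtain ⟨r, R, h0, hr, hR, -, hL⟩ := exists_hasLaurentOn_inv_prod t fun ρ hρ =>
    (Multiset.mem_filter.1 hρ).2
  refine ⟨r, R, h0, hr, hR, fun b hb => ?_⟩
  -- Only the roots on the circle must cancel against `b`. The others determine the annulus, which
  -- is thus the same for every `b`.
  have hsb : (s.map fun ρ => X - C ρ).prod ∣ b := by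
    rcases eq_or_ne b 0 with rfl | hb0
    · simp
    refine (Multiset.prod_X_sub_C_dvd_iff_le_roots hb0 s).2 (Multiset.le_iff_count.2 fun l => ?_)
    by_cases hl : ‖l‖ = 1
    · rw [hs, Multiset.count_filter_of_pos (p := fun ρ : ℂ => ‖ρ‖ = 1) hl, count_roots, count_roots]
      exact (le_rootMultiplicity_iff hb0).2 (hb l hl _ (pow_rootMultiplicity_dvd a l))
    · rw [hs, Multiset.count_filter_of_neg (p := fun ρ : ℂ => ‖ρ‖ = 1) hl]; exact Nat.zero_le _
  obtain ⟨b₁, hb₁⟩ := hsb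
  refine ⟨_, (((hasLaurentOn_polynomial r R (C a.leadingCoeff⁻¹)).mul h0
    (hasLaurentOn_polynomial r R b₁)).mul h0 hL), fun z hz => ?_⟩
  have hfac : a.eval z = a.leadingCoeff * ((s.map fun ρ => X - C ρ).prod.eval z *
      (t.map fun ρ => z - ρ).prod) := by
    have h1 := (IsAlgClosed.splits a).eval_eq_prod_roots z
    rw [← Multiset.filter_add_not (fun ρ : ℂ => ‖ρ‖ = 1) a.roots, Multiset.map_add,
      Multiset.prod_add] at h1
    rw [h1, eval_multiset_prod, Multiset.map_map]
    simp [hs, ht]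
  rw [hfac] at hz ⊢
  have hz1 := left_ne_zero_of_mul hz
  have hz2 := left_ne_zero_of_mul (right_ne_zero_of_mul hz)
  have hz3 := right_ne_zero_of_mul (right_ne_zero_of_mul hz)
  rw [hb₁, eval_mul, eval_C]
  field_simp

/-! ### Scalar difference equations with orthogonal noise in a Hilbert space -/

section Lag

variable {H : Type*} [NormedAddCommGroup H]

/-- The backward shift on two-sided sequences. -/
def lag (H : Type*) [NormedAddCommGroup H] [Module ℂ H] : Module.End ℂ (ℤ → H) :=
  LinearMap.funLeft ℂ H fun t => t - 1

lemma lag_apply [Module ℂ H] (x : ℤ → H) (t : ℤ) : lag H x t = x (t - 1) := rfl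

lemma lag_pow_apply [Module ℂ H] (x : ℤ → H) (k : ℕ) (t : ℤ) : (lag H ^ k) x t = x (t - k) := by
  induction k generalizing t with
  | zero => simp
  | succ k ih =>
    rw [pow_succ', Module.End.mul_apply, lag_apply, ih]
    congr 1; push_cast; ring

open Polynomial in
lemma aeval_lag_monomial_apply [Module ℂ H] (x : ℤ → H) (k : ℕ) (a : ℂ) (t : ℤ) :
    aeval (lag H) (monomial k a) x t = a • x (t - k) := by
  rw [aeval_monomial, Module.End.mul_apply, Module.algebraMap_end_apply, Pi.smul_apply,
    lag_pow_apply]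

variable [InnerProductSpace ℂ H]

open Polynomial in
lemma exists_norm_aeval_lag_le {x : ℤ → H} (hx : ∃ C, ∀ t, ‖x t‖ ≤ C) (p : Polynomial ℂ) :
    ∃ C, ∀ t, ‖aeval (lag H) p x t‖ ≤ C := by
  induction p using Polynomial.induction_on' with
  | add p q hp hq =>
    obtain ⟨C, hC⟩ := hp
    obtain ⟨D, hD⟩ := hq
    refine ⟨C + D, fun t => ?_⟩
    rw [map_add, LinearMap.add_apply, Pi.add_apply]
    exact (norm_add_le _ _).trans (add_le_add (hC t) (hD t))
  | monomial n a =>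
    obtain ⟨C, hC⟩ := hx
    refine ⟨‖a‖ * C, fun t => ?_⟩
    rw [aeval_lag_monomial_apply, norm_smul]
    exact mul_le_mul_of_nonneg_left (hC _) (norm_nonneg _)

lemma norm_sq_sum_range_of_orthogonal {z : ℕ → H} {V : ℝ}
    (hz : ∀ s t, inner ℂ (z s) (z t) = if s = t then (V : ℂ) else 0) (n : ℕ) :
    ‖∑ t ∈ Finset.range n, z t‖ ^ 2 = n * V := by
  have h : inner ℂ (∑ t ∈ Finset.range n, z t) (∑ t ∈ Finset.range n, z t) = ((n * V : ℝ) : ℂ) := by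
    rw [sum_inner]
    simp only [inner_sum, hz]
    simp +contextual [Finset.sum_ite_eq]
  rw [norm_sq_eq_re_inner (𝕜 := ℂ), h]
  simp

/-- A drift plus an orthogonal random walk with increments of constant variance `V` can only stay
bounded if both vanish. -/
lemma eq_zero_of_bounded_drift_add_walk {z : ℕ → H} {V : ℝ} {E : H} {C : ℝ} (hV : 0 ≤ V)
    (hz : ∀ s t, inner ℂ (z s) (z t) = if s = t then (V : ℂ) else 0)
    (hC : ∀ n : ℕ, ‖(n : ℂ) • E + ∑ t ∈ Finset.range n, z t‖ ≤ C) : E = 0 ∧ V = 0 := by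
  have hS : ∀ n : ℕ, ‖∑ t ∈ Finset.range n, z t‖ = √(n * V) := fun n => by
    rw [← norm_sq_sum_range_of_orthogonal hz n, Real.sqrt_sq (norm_nonneg _)]
  have hE : E = 0 := by
    by_contra hE
    have hpos : 0 < ‖E‖ := norm_pos_iff.2 hE
    have hle : ∀ n : ℕ, n * ‖E‖ ≤ C + √(n * V) := fun n => by
      have h1 : ‖(n : ℂ) • E‖ = n * ‖E‖ := by rw [norm_smul, Complex.norm_natCast]
      have h2 := norm_sub_le ((n : ℂ) • E + ∑ t ∈ Finset.range n, z t) (∑ t ∈ Finset.range n, z t)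
      rw [add_sub_cancel_right, h1, hS] at h2
      linarith [hC n]
    have hC0 : 0 ≤ C := (norm_nonneg _).trans (hC 0)
    -- Square `n ‖E‖ - C ≤ √(n V)`, drop `C ^ 2` and divide by `n`: the left side is then linear in
    -- `n`, the right side constant.
    have hlim : ∀ n : ℕ, (n : ℝ) * ‖E‖ ^ 2 ≤ 2 * C * ‖E‖ + V := fun n => by
      by_cases hn : n * ‖E‖ ≤ C
      · nlinarith
      · have hn' := (sub_pos.2 (not_le.1 hn))
        have h1 : (n * ‖E‖ - C) ^ 2 ≤ n * V := by
          have := Real.sq_sqrt (show 0 ≤ n * V by positivity)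
          rw [← this]
          exact pow_le_pow_left₀ hn'.le (by linarith [hle n]) 2
        rcases Nat.eq_zero_or_pos n with rfl | hn0
        · simp; positivity
        · have hn1 : (0 : ℝ) < n := by exact_mod_cast hn0
          have : (n : ℝ) * (n * ‖E‖ ^ 2) ≤ n * (2 * C * ‖E‖ + V) := by nlinarith [sq_nonneg C]
          exact le_of_mul_le_mul_left this hn1
    obtain ⟨n, hn⟩ := exists_nat_gt ((2 * C * ‖E‖ + V) / ‖E‖ ^ 2)
    rw [div_lt_iff₀ (by positivity)] at hn
    exact absurd (hlim n) (not_le.2 hn)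
  refine ⟨hE, ?_⟩
  by_contra hV0
  have hVpos : 0 < V := lt_of_le_of_ne hV (Ne.symm hV0)
  obtain ⟨n, hn⟩ := exists_nat_gt (C ^ 2 / V)
  rw [div_lt_iff₀ hVpos, ← norm_sq_sum_range_of_orthogonal hz n] at hn
  have h1 := hC n
  rw [hE, smul_zero, zero_add] at h1
  exact absurd (pow_le_pow_left₀ (norm_nonneg _) h1 2) (not_le.2 hn)

/-- The weight `l ^ (t + 1)` turns each term into a difference of consecutive values of `l ^ (t + 1)
• u t`. -/
lemma sum_range_pow_smul_lag_sub (l : ℂ) (u : ℤ → H) (n : ℕ) :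
    ∑ t ∈ Finset.range n, l ^ (t + 1) • (u t - l • u (t + 1)) =
      l • u 0 - l ^ (n + 1) • u n := by
  induction n with
  | zero => simp
  | succ n ih =>
    rw [Finset.sum_range_succ, ih]
    push_cast
    rw [smul_sub, smul_smul, ← pow_succ]
    abel

open Polynomial in
/-- If an autoregressive equation with orthogonal innovations has a bounded solution, up to a
sequence in the kernel of `lag - l`, then every zero `l` on the unit circle of the autoregressive
polynomial is a zero of the moving average polynomials, and the equation holds exactly. -/
lemma eval_eq_zero_of_bounded_solution {ι : Type*} [Fintype ι] [DecidableEq ι] {l : ℂ}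
    (hl : ‖l‖ = 1) {x : ℤ → H}
    (hx : ∃ C, ∀ t, ‖x t‖ ≤ C) {y : ι → ℤ → H} {v : ι → ℝ} (hv : ∀ j, 0 ≤ v j)
    (hy : ∀ j k s t, inner ℂ (y j s) (y k t) = if j = k ∧ s = t then (v j : ℂ) else 0)
    (a : Polynomial ℂ) (b : ι → Polynomial ℂ)
    (h : (lag H - algebraMap ℂ _ l) (aeval (lag H) ((X - C l) * a) x -
      ∑ j, aeval (lag H) (b j) (y j)) = 0) :
    aeval (lag H) ((X - C l) * a) x - ∑ j, aeval (lag H) (b j) (y j) = 0 ∧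
      ∀ j, v j ≠ 0 → (b j).eval l = 0 := by
  have hl0 : l ≠ 0 := norm_ne_zero_iff.1 (by rw [hl]; exact one_ne_zero)
  set D := aeval (lag H) ((X - C l) * a) x - ∑ j, aeval (lag H) (b j) (y j) with hD
  have hstep : ∀ t, D (t - 1) = l • D t := fun t => by
    have := congrFun h t
    rw [LinearMap.sub_apply, Module.algebraMap_end_apply, Pi.sub_apply, lag_apply] at this
    exact sub_eq_zero.1 this
  have hD0 : ∀ n : ℕ, l ^ n • D n = D 0 := fun n => by
    induction n with
    | zero => simp
    | succ n ih =>
      rw [← ih, pow_succ, mul_smul, ← hstep]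
      congr 2; push_cast; ring
  have hyb : ∀ j, ∃ C, ∀ t, ‖y j t‖ ≤ C := fun j => by
    refine ⟨√(v j), fun t => Real.le_sqrt_of_sq_le ?_⟩
    rw [norm_sq_eq_re_inner (𝕜 := ℂ), hy]
    simp
  -- Splitting `b j` into its value at `l` and a multiple of `X - l` lets all multiples of `X - l`
  -- be collected in one bounded sequence `u`.
  choose b' hb' using fun j => X_sub_C_dvd_sub_C_eval (a := l) (p := b j)
  have hb : ∀ j, b j = C ((b j).eval l) + (X - C l) * b' j := fun j => by rw [← hb' j]; ring
  set u := aeval (lag H) a x - ∑ j, aeval (lag H) (b' j) (y j) with hu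
  have hub : ∃ C, ∀ t, ‖u t‖ ≤ C := by
    obtain ⟨C, hC⟩ := exists_norm_aeval_lag_le hx a
    choose K hK using fun j => exists_norm_aeval_lag_le (hyb j) (b' j)
    refine ⟨C + ∑ j, K j, fun t => ?_⟩
    rw [hu, Pi.sub_apply, Finset.sum_apply]
    exact (norm_sub_le _ _).trans (add_le_add (hC t)
      ((norm_sum_le _ _).trans (Finset.sum_le_sum fun j _ => hK j t)))
  have hXl : ∀ w : ℤ → H, ∀ t, aeval (lag H) (X - C l) w t = w (t - 1) - l • w t := fun w t => by
    rw [map_sub, aeval_X, aeval_C, LinearMap.sub_apply, Module.algebraMap_end_apply]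
    rfl
  have hDu : ∀ t, D t = (u (t - 1) - l • u t) - ∑ j, (b j).eval l • y j t := fun t => by
    have h1 : D = aeval (lag H) (X - C l) u - ∑ j, (b j).eval l • y j := by
      rw [hu, map_sub, map_sum, hD, map_mul, Module.End.mul_apply, sub_sub,
        ← Finset.sum_add_distrib]
      congr 1
      refine Finset.sum_congr rfl fun j _ => ?_
      conv_lhs => rw [hb j]
      rw [map_add, map_mul, aeval_C, LinearMap.add_apply, Module.End.mul_apply,
        Module.algebraMap_end_apply, add_comm]
    rw [h1, Pi.sub_apply, hXl, Finset.sum_apply]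
    rfl
  -- The weights have modulus one, so `z` stays orthogonal with variance `V`; they also make `D`
  -- constant and the terms in `u` telescope.
  set z : ℕ → H := fun t => l ^ (t + 1) • ∑ j, (b j).eval l • y j ((t : ℤ) + 1) with hz
  set V : ℝ := ∑ j, ‖(b j).eval l‖ ^ 2 * v j with hV
  have hVnn : 0 ≤ V := Finset.sum_nonneg fun j _ => mul_nonneg (sq_nonneg _) (hv j)
  have hzV : ∀ s t, inner ℂ (z s) (z t) = if s = t then (V : ℂ) else 0 := fun s t => by
    have h1 : inner ℂ (∑ j, (b j).eval l • y j ((s : ℤ) + 1))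
        (∑ j, (b j).eval l • y j ((t : ℤ) + 1)) = if s = t then (V : ℂ) else 0 := by
      rw [sum_inner]
      simp only [inner_sum, inner_smul_left, inner_smul_right, hy]
      split_ifs with hst
      · subst hst
        rw [hV]
        push_cast
        refine Finset.sum_congr rfl fun j _ => ?_
        rw [Finset.sum_eq_single j (fun k _ hk => by simp [Ne.symm hk]) (by simp)]
        rw [← Complex.conj_mul']
        simp [mul_assoc, mul_left_comm]
      · have : ¬ ((s : ℤ) + 1 = t + 1) := by omega
        simp [this]
    rw [hz]
    simp only
    rw [inner_smul_left, inner_smul_right, h1]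
    split_ifs with hst
    · subst hst
      rw [← mul_assoc, Complex.conj_mul', norm_pow, hl]
      simp
    · simp
  obtain ⟨K, hK⟩ := hub
  have hsum : ∀ n : ℕ, (n : ℂ) • D 0 + ∑ t ∈ Finset.range n, z t =
      l • u 0 - l ^ (n + 1) • u n := fun n => by
    rw [← sum_range_pow_smul_lag_sub]
    have h1 : (n : ℂ) • D 0 = ∑ t ∈ Finset.range n, l ^ (t + 1) • D ((t : ℤ) + 1) := by
      rw [Finset.sum_congr rfl fun t _ => by
        have := hD0 (t + 1); push_cast at this; exact this]
      simp [Nat.cast_smul_eq_nsmul]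
    rw [h1, ← Finset.sum_add_distrib]
    refine Finset.sum_congr rfl fun t _ => ?_
    rw [hz, ← smul_add, hDu, sub_add_cancel, add_sub_cancel_right]
  have hbd : ∀ n : ℕ, ‖(n : ℂ) • D 0 + ∑ t ∈ Finset.range n, z t‖ ≤ K + K := fun n => by
    rw [hsum]
    refine (norm_sub_le _ _).trans (add_le_add ?_ ?_)
    · rw [norm_smul, hl, one_mul]; exact hK _
    · rw [norm_smul, norm_pow, hl, one_pow, one_mul]; exact hK _
  obtain ⟨hE, hV0⟩ := eq_zero_of_bounded_drift_add_walk hVnn hzV hbd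
  constructor
  · have hup : ∀ n : ℕ, D n = 0 := fun n => by
      have := hD0 n
      rw [hE] at this
      exact (smul_eq_zero.1 this).resolve_left (pow_ne_zero _ hl0)
    have hdown : ∀ n : ℕ, D (-n) = 0 := fun n => by
      induction n with
      | zero => simpa using hE
      | succ n ih =>
        have := hstep (-n)
        rw [ih, smul_zero] at this
        rw [← this]; congr 1; push_cast; ring
    ext t
    obtain ⟨n, rfl | rfl⟩ := t.eq_nat_or_neg
    · exact hup n
    · exact hdown n
  · intro j hj
    have h1 := (Finset.sum_eq_zero_iff_of_nonneg fun j _ =>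
      mul_nonneg (sq_nonneg ‖(b j).eval l‖) (hv j)).1 hV0 j (Finset.mem_univ j)
    simpa [hj] using h1

open Polynomial in
-- Induction on `n`, one zero at a time. Assuming the equation only up to the kernel of `lag - l`
-- makes this work: cancelling a factor from an exact equation yields precisely that. A noise of
-- variance zero gives no information, so its polynomial is required to vanish.
lemma X_sub_C_pow_dvd_of_bounded_solution {ι : Type*} [Fintype ι] [DecidableEq ι] {l : ℂ}
    (hl : ‖l‖ = 1) {x : ℤ → H} (hx : ∃ C, ∀ t, ‖x t‖ ≤ C) {y : ι → ℤ → H} {v : ι → ℝ}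
    (hv : ∀ j, 0 ≤ v j)
    (hy : ∀ j k s t, inner ℂ (y j s) (y k t) = if j = k ∧ s = t then (v j : ℂ) else 0)
    (a : Polynomial ℂ) (n : ℕ) (b : ι → Polynomial ℂ) (hb : ∀ j, v j = 0 → b j = 0)
    (h : (lag H - algebraMap ℂ _ l) (aeval (lag H) ((X - C l) ^ n * a) x -
      ∑ j, aeval (lag H) (b j) (y j)) = 0) (j : ι) :
    (X - C l) ^ n ∣ b j := by
  induction n generalizing b j with
  | zero => simp
  | succ n ih =>
    rw [pow_succ', mul_assoc] at h
    obtain ⟨h0, hroot⟩ := eval_eq_zero_of_bounded_solution hl hx hv hy _ b h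
    have hdvd : ∀ j, X - C l ∣ b j := fun j => by
      by_cases hj : v j = 0
      · simp [hb j hj]
      · exact dvd_iff_isRoot.2 (hroot j hj)
    choose b' hb' using hdvd
    have hXC : (X - C l : Polynomial ℂ) ≠ 0 := X_sub_C_ne_zero l
    have hb0 : ∀ j, v j = 0 → b' j = 0 := fun j hj => by
      have := hb j hj
      rw [hb' j] at this
      exact (mul_eq_zero.1 this).resolve_left hXC
    have key : (lag H - algebraMap ℂ _ l) (aeval (lag H) ((X - C l) ^ n * a) x -
        ∑ j, aeval (lag H) (b' j) (y j)) = 0 := by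
      refine Eq.trans ?_ h0
      have e : lag H - algebraMap ℂ (Module.End ℂ (ℤ → H)) l = aeval (lag H) (X - C l) := by simp
      rw [e, map_sub (aeval (lag H) (X - C l)), map_sum, ← Module.End.mul_apply, ← map_mul]
      refine congrArg _ (Finset.sum_congr rfl fun j _ => ?_)
      rw [hb' j, map_mul, Module.End.mul_apply]
    rw [hb' j, pow_succ']
    exact mul_dvd_mul_left _ (ih b' hb0 key j)

end Lag

/-! ### Matrix polynomials and the Laurent expansion of the transfer function -/

section Polynomials

open Polynomial

variable {m d p q : ℕ}

/-- The autoregressive polynomial as a matrix of polynomials. -/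
noncomputable def arPolyMatrix (Ψ : Fin p → Matrix (Fin m) (Fin m) ℂ) :
    Matrix (Fin m) (Fin m) (Polynomial ℂ) :=
  1 - ∑ k : Fin p, Matrix.of fun i j => monomial (k.val + 1) (Ψ k i j)

/-- The moving average polynomial as a matrix of polynomials. -/
noncomputable def maPolyMatrix (Θ : Fin (q + 1) → Matrix (Fin m) (Fin d) ℂ) :
    Matrix (Fin m) (Fin d) (Polynomial ℂ) :=
  ∑ k : Fin (q + 1), Matrix.of fun i j => monomial k.val (Θ k i j)

lemma eval_arPolyMatrix (Ψ : Fin p → Matrix (Fin m) (Fin m) ℂ) (z : ℂ) :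
    (arPolyMatrix Ψ).map (Polynomial.evalRingHom z) = arPoly Ψ z := by
  ext i j
  simp only [arPolyMatrix, arPoly, Matrix.map_apply, Matrix.sub_apply, Matrix.sum_apply,
    Matrix.of_apply, Matrix.smul_apply, coe_evalRingHom, eval_sub, eval_finsetSum,
    eval_monomial, smul_eq_mul]
  congr 1
  · by_cases h : i = j
    · subst h; simp
    · rw [Matrix.one_apply_ne h, Matrix.one_apply_ne h, eval_zero]
  · exact Finset.sum_congr rfl fun _ _ => mul_comm _ _

lemma eval_maPolyMatrix (Θ : Fin (q + 1) → Matrix (Fin m) (Fin d) ℂ) (z : ℂ) :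
    (maPolyMatrix Θ).map (Polynomial.evalRingHom z) = maPoly Θ z := by
  ext i j
  simp only [maPolyMatrix, maPoly, Matrix.map_apply, Matrix.sum_apply,
    Matrix.of_apply, Matrix.smul_apply, coe_evalRingHom, eval_finsetSum,
    eval_monomial, smul_eq_mul]
  exact Finset.sum_congr rfl fun _ _ => mul_comm _ _

lemma eval_det_arPolyMatrix (Ψ : Fin p → Matrix (Fin m) (Fin m) ℂ) (z : ℂ) :
    (arPolyMatrix Ψ).det.eval z = (arPoly Ψ z).det := by
  rw [← eval_arPolyMatrix, ← coe_evalRingHom, RingHom.map_det]; rfl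

lemma det_arPolyMatrix_ne_zero (Ψ : Fin p → Matrix (Fin m) (Fin m) ℂ) :
    (arPolyMatrix Ψ).det ≠ 0 := by
  intro h
  have h1 := eval_det_arPolyMatrix Ψ 0
  rw [h, eval_zero] at h1
  simp [arPoly] at h1

/-- The numerator of the rational matrix function `P⁻¹ Q`, with denominator `det P`. -/
noncomputable def transferNum (Ψ : Fin p → Matrix (Fin m) (Fin m) ℂ)
    (Θ : Fin (q + 1) → Matrix (Fin m) (Fin d) ℂ) : Matrix (Fin m) (Fin d) (Polynomial ℂ) :=
  (arPolyMatrix Ψ).adjugate * maPolyMatrix Θ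

/-- Cramer's rule. It holds at every `z`: where `det P(z) = 0`, both sides are zero by convention.
-/
lemma inv_arPoly_mul_maPoly_apply (Ψ : Fin p → Matrix (Fin m) (Fin m) ℂ)
    (Θ : Fin (q + 1) → Matrix (Fin m) (Fin d) ℂ) (z : ℂ) (i : Fin m) (j : Fin d) :
    ((arPoly Ψ z)⁻¹ * maPoly Θ z) i j =
      (transferNum Ψ Θ i j).eval z / (arPolyMatrix Ψ).det.eval z := by
  have h : (transferNum Ψ Θ).map (Polynomial.evalRingHom z) =
      (arPoly Ψ z).adjugate * maPoly Θ z := by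
    rw [transferNum, Matrix.map_mul, eval_maPolyMatrix, ← eval_arPolyMatrix,
      ← RingHom.mapMatrix_apply, RingHom.map_adjugate]
    rfl
  rw [Matrix.inv_def, Ring.inverse_eq_inv', Matrix.smul_mul, ← h, eval_det_arPolyMatrix,
    Matrix.smul_apply, Matrix.map_apply, smul_eq_mul, coe_evalRingHom, div_eq_inv_mul]

/-- Absorbing `U^* diag(Id_s, 0)` into the moving average coefficients reduces everything to the
form `P⁻¹ Q`. -/
lemma transfer_eq (Ψ : Fin p → Matrix (Fin m) (Fin m) ℂ)
    (Θ : Fin (q + 1) → Matrix (Fin m) (Fin d) ℂ) (U : Matrix (Fin d) (Fin d) ℂ) (s : ℕ) (z : ℂ) :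
    transfer Ψ Θ U s z = (arPoly Ψ z)⁻¹ *
      maPoly (fun k => Θ k * (Uᴴ * padDiag d (fun _ : Fin s => (1 : ℂ)))) z := by
  rw [transfer, Matrix.mul_assoc, Matrix.mul_assoc]
  congr 1
  simp only [maPoly, Matrix.sum_mul, Matrix.smul_mul]

/-- `P⁻¹ Q` has only removable singularities on the unit circle if and only if the numerators
vanish there to at least the order of the denominator `det P`. -/
lemma onlyRemovableOnCircle_iff (Ψ : Fin p → Matrix (Fin m) (Fin m) ℂ)
    (Θ : Fin (q + 1) → Matrix (Fin m) (Fin d) ℂ) :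
    OnlyRemovableOnCircle (fun z => (arPoly Ψ z)⁻¹ * maPoly Θ z) ↔
      ∀ i j, ∀ l : ℂ, ‖l‖ = 1 → ∀ n : ℕ,
        (X - C l) ^ n ∣ (arPolyMatrix Ψ).det → (X - C l) ^ n ∣ transferNum Ψ Θ i j := by
  simp only [OnlyRemovableOnCircle, inv_arPoly_mul_maPoly_apply]
  constructor
  · intro h i j l hl n hn
    obtain ⟨f, hf, hev⟩ := h l hl i j
    exact X_sub_C_pow_dvd_of_removable (det_arPolyMatrix_ne_zero Ψ) hf.continuousAt hev hn
  · intro h l hl i j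
    exact exists_analyticAt_of_X_sub_C_pow_dvd (det_arPolyMatrix_ne_zero Ψ) (h i j l hl)

lemma hasSum_matrix_iff {ι : Type*} {f : ι → Matrix (Fin m) (Fin d) ℂ}
    {a : Matrix (Fin m) (Fin d) ℂ} :
    HasSum f a ↔ ∀ i j, HasSum (fun n => f n i j) (a i j) := by
  refine Pi.hasSum.trans (forall_congr' fun i => ?_)
  exact Pi.hasSum

/-- All entries share the denominator `det P`, hence one common annulus. -/
theorem exists_isLaurentExpansion (Ψ : Fin p → Matrix (Fin m) (Fin m) ℂ)
    (Θ : Fin (q + 1) → Matrix (Fin m) (Fin d) ℂ) (U : Matrix (Fin d) (Fin d) ℂ) (s : ℕ)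
    (h : OnlyRemovableOnCircle (transfer Ψ Θ U s)) :
    ∃ c : ℤ → Matrix (Fin m) (Fin d) ℂ, IsLaurentExpansion Ψ Θ U s c := by
  rw [funext (transfer_eq Ψ Θ U s), onlyRemovableOnCircle_iff] at h
  obtain ⟨r, R, h0, hr, hR, hL⟩ := exists_hasLaurentOn_div (arPolyMatrix Ψ).det
  choose f hf hfeq using fun i j => hL _ (h i j)
  choose c hc using hf
  refine ⟨fun n => Matrix.of fun i j => c i j n, r, R, h0, hr, hR, fun z h1 h2 => ⟨fun i j => ?_,
    fun hdet => hasSum_matrix_iff.2 fun i j => ?_⟩⟩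
  · exact (hc i j z h1 h2).1
  · rw [transfer_eq, inv_arPoly_mul_maPoly_apply, hfeq i j z (by rwa [eval_det_arPolyMatrix])]
    exact (hc i j z h1 h2).2

lemma hasSum_const_matrix_mul {ι : Type*} {k : ℕ} {f : ι → Matrix (Fin m) (Fin d) ℂ}
    {a : Matrix (Fin m) (Fin d) ℂ} (h : HasSum f a) (A : Matrix (Fin k) (Fin m) ℂ) :
    HasSum (fun n => A * f n) (A * a) :=
  h.map (Matrix.addMonoidHomMulLeft A) (continuous_const.matrix_mul continuous_id)

lemma hasSum_arPoly_mul {Ψ : Fin p → Matrix (Fin m) (Fin m) ℂ} {z : ℂ} (hz : z ≠ 0)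
    {c : ℤ → Matrix (Fin m) (Fin d) ℂ} {T : Matrix (Fin m) (Fin d) ℂ}
    (h : HasSum (fun n : ℤ => z ^ n • c n) T) :
    HasSum (fun n : ℤ => z ^ n • (c n - ∑ k : Fin p, Ψ k * c (n - ((k.val : ℤ) + 1))))
      (arPoly Ψ z * T) := by
  rw [arPoly, Matrix.sub_mul, Matrix.one_mul, Matrix.sum_mul]
  simp only [smul_sub, Finset.smul_sum]
  refine h.sub (hasSum_sum fun k _ => ?_)
  have h1 := hasSum_const_matrix_mul ((Equiv.subRight ((k.val : ℤ) + 1)).hasSum_iff.2 h)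
    (z ^ (k.val + 1) • Ψ k)
  refine h1.congr_fun fun n => ?_
  rw [Function.comp_apply, Equiv.subRight_apply, Matrix.smul_mul, Matrix.mul_smul, smul_smul,
    ← zpow_natCast, ← zpow_add₀ hz]
  congr 2
  push_cast; ring

lemma hasSum_maPoly (Θ : Fin (q + 1) → Matrix (Fin m) (Fin d) ℂ) (z : ℂ) :
    HasSum (fun n : ℤ => z ^ n • ∑ k : Fin (q + 1), if n = (k.val : ℤ) then Θ k else 0)
      (maPoly Θ z) := by
  simp only [Finset.smul_sum, maPoly]
  refine hasSum_sum fun k _ => ?_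
  refine (hasSum_ite_eq (k.val : ℤ) (z ^ k.val • Θ k)).congr_fun fun n => ?_
  by_cases hn : n = (k.val : ℤ)
  · simp [hn]
  · simp [hn]

lemma IsLaurentExpansion.summable_norm {Ψ : Fin p → Matrix (Fin m) (Fin m) ℂ}
    {Θ : Fin (q + 1) → Matrix (Fin m) (Fin d) ℂ} {U : Matrix (Fin d) (Fin d) ℂ} {s : ℕ}
    {c : ℤ → Matrix (Fin m) (Fin d) ℂ} (hc : IsLaurentExpansion Ψ Θ U s c) (i : Fin m)
    (j : Fin d) : Summable fun n => ‖c n i j‖ := by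
  obtain ⟨r, R, h0, hr, hR, h⟩ := hc
  simpa using (h 1 (by simpa using hr) (by simpa using hR)).1 i j

/-- Comparison of coefficients in `P(z) M(z) = Q(z) U^* diag(Id_s, 0)`. -/
theorem IsLaurentExpansion.recursion {Ψ : Fin p → Matrix (Fin m) (Fin m) ℂ}
    {Θ : Fin (q + 1) → Matrix (Fin m) (Fin d) ℂ} {U : Matrix (Fin d) (Fin d) ℂ} {s : ℕ}
    {c : ℤ → Matrix (Fin m) (Fin d) ℂ} (hc : IsLaurentExpansion Ψ Θ U s c) (n : ℤ) :
    c n - ∑ k : Fin p, Ψ k * c (n - ((k.val : ℤ) + 1)) =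
      ∑ k : Fin (q + 1), if n = (k.val : ℤ) then
        Θ k * (Uᴴ * padDiag d (fun _ : Fin s => (1 : ℂ))) else 0 := by
  have hs := hc.summable_norm
  obtain ⟨r, R, h0, hr, hR, h⟩ := hc
  set Θ' : Fin (q + 1) → Matrix (Fin m) (Fin d) ℂ :=
    fun k => Θ k * (Uᴴ * padDiag d (fun _ : Fin s => (1 : ℂ))) with hΘ'
  -- `e` is the defect in the recursion. Its Laurent series vanishes on the circle off the finitely
  -- many zeros of `det P`, so uniqueness of coefficients gives `e = 0`.
  set e : ℤ → Matrix (Fin m) (Fin d) ℂ := fun n =>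
    (c n - ∑ k : Fin p, Ψ k * c (n - ((k.val : ℤ) + 1))) -
      ∑ k : Fin (q + 1), if n = (k.val : ℤ) then Θ' k else 0 with he
  have hsum : ∀ z : ℂ, z ≠ 0 → ∀ T, HasSum (fun n : ℤ => z ^ n • c n) T →
      HasSum (fun n : ℤ => z ^ n • e n) (arPoly Ψ z * T - maPoly Θ' z) := fun z hz T hT => by
    simp only [he, smul_sub (M := ℂ) (A := Matrix (Fin m) (Fin d) ℂ)]
    simpa only [smul_sub] using (hasSum_arPoly_mul (Ψ := Ψ) hz hT).sub (hasSum_maPoly Θ' z)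
  -- Evaluation at `z = 1` gives summability; the sum there is taken entrywise, since `P(1)` may be
  -- singular.
  have hes : ∀ i j, Summable fun n => ‖e n i j‖ := fun i j => by
    have h1 : HasSum (fun n : ℤ => (1 : ℂ) ^ n • c n) (Matrix.of fun i j => ∑' n, c n i j) := by
      refine hasSum_matrix_iff.2 fun i j => ?_
      simpa using (hs i j).of_norm.hasSum
    have h2 := hasSum_matrix_iff.1 (hsum 1 one_ne_zero _ h1) i j
    simpa using h2.summable.norm
  suffices e n = 0 from sub_eq_zero.1 this
  ext i j
  refine laurent_coeff_eq_zero (hes i j)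
    (S := {z | (arPolyMatrix Ψ).det.IsRoot z}) ?_ (fun z hz hzS => ?_) n
  · exact Polynomial.finite_setOfPred_isRoot (det_arPolyMatrix_ne_zero Ψ)
  · have hdet : (arPoly Ψ z).det ≠ 0 := by rwa [← eval_det_arPolyMatrix]
    have hz0 : z ≠ 0 := norm_ne_zero_iff.1 (by rw [hz]; exact one_ne_zero)
    have h1 := hsum z hz0 _ ((h z (by rwa [hz]) (by rwa [hz])).2 hdet)
    rw [transfer_eq, Matrix.mul_nonsing_inv_cancel_left _ _ (isUnit_iff_ne_zero.2 hdet),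
      sub_self] at h1
    exact hasSum_matrix_iff.1 h1 i j

end Polynomials

/-! ### Decoupling the matrix equation -/

section Difference

open Polynomial

variable {H : Type*} [NormedAddCommGroup H] [InnerProductSpace ℂ H] {m d p q : ℕ}

/-- Multiplying the ARMA equation by the adjugate of `P(B)`. -/
lemma aeval_det_arPolyMatrix {Ψ : Fin p → Matrix (Fin m) (Fin m) ℂ}
    {Θ : Fin (q + 1) → Matrix (Fin m) (Fin d) ℂ} {x : Fin m → ℤ → H} {y : Fin d → ℤ → H}
    (h : ∀ t i, x i t - ∑ k : Fin p, ∑ j, Ψ k i j • x j (t - ((k.val : ℤ) + 1)) =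
      ∑ k : Fin (q + 1), ∑ j, Θ k i j • y j (t - (k.val : ℤ))) (i : Fin m) :
    aeval (lag H) (arPolyMatrix Ψ).det (x i) =
      ∑ j, aeval (lag H) (transferNum Ψ Θ i j) (y j) := by
  have hx : ∀ i', ∑ j, aeval (lag H) (arPolyMatrix Ψ i' j) (x j) =
      ∑ j, aeval (lag H) (maPolyMatrix Θ i' j) (y j) := fun i' => by
    ext t
    have h1 : ∀ j, aeval (lag H) (arPolyMatrix Ψ i' j) (x j) t =
        (if i' = j then x j t else 0) -
          ∑ k : Fin p, Ψ k i' j • x j (t - ((k.val : ℤ) + 1)) := fun j => by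
      simp only [arPolyMatrix, Matrix.sub_apply, Matrix.sum_apply, Matrix.of_apply, map_sub,
        map_sum, LinearMap.sub_apply, LinearMap.sum_apply, Pi.sub_apply, Finset.sum_apply,
        aeval_lag_monomial_apply]
      push_cast
      congr 1
      split_ifs with hij
      · rw [hij, Matrix.one_apply_eq, map_one, Module.End.one_apply]
      · rw [Matrix.one_apply_ne hij, map_zero, LinearMap.zero_apply, Pi.zero_apply]
    have h2 : ∀ j, aeval (lag H) (maPolyMatrix Θ i' j) (y j) t =
        ∑ k : Fin (q + 1), Θ k i' j • y j (t - (k.val : ℤ)) := fun j => by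
      simp only [maPolyMatrix, Matrix.sum_apply, Matrix.of_apply,
        map_sum, LinearMap.sum_apply, Finset.sum_apply, aeval_lag_monomial_apply]
    rw [Finset.sum_apply, Finset.sum_apply]
    simp only [h1, h2]
    rw [Finset.sum_sub_distrib, Finset.sum_ite_eq, if_pos (Finset.mem_univ _),
      Finset.sum_comm, h, Finset.sum_comm]
  have comp : ∀ {r n : ℕ} (A : Matrix (Fin m) (Fin r) ℂ[X]) (B : Matrix (Fin r) (Fin n) ℂ[X])
      (w : Fin n → ℤ → H), ∑ j, aeval (lag H) ((A * B) i j) (w j) =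
        ∑ i', aeval (lag H) (A i i') (∑ j, aeval (lag H) (B i' j) (w j)) := fun A B w => by
    simp only [Matrix.mul_apply, map_sum, map_mul, LinearMap.sum_apply, Module.End.mul_apply]
    exact Finset.sum_comm
  rw [transferNum, comp]
  simp only [← hx]
  rw [← comp, Matrix.adjugate_mul]
  rw [Finset.sum_eq_single i]
  · simp
  · intro j _ hj
    rw [Matrix.smul_apply, Matrix.one_apply_ne (Ne.symm hj), smul_zero, map_zero,
      LinearMap.zero_apply]
  · simp

lemma onlyRemovableOnCircle_of_bounded {Ψ : Fin p → Matrix (Fin m) (Fin m) ℂ}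
    {Θ : Fin (q + 1) → Matrix (Fin m) (Fin d) ℂ} {x : Fin m → ℤ → H} {y : Fin d → ℤ → H}
    (h : ∀ t i, x i t - ∑ k : Fin p, ∑ j, Ψ k i j • x j (t - ((k.val : ℤ) + 1)) =
      ∑ k : Fin (q + 1), ∑ j, Θ k i j • y j (t - (k.val : ℤ)))
    (hx : ∀ i, ∃ C, ∀ t, ‖x i t‖ ≤ C) {v : Fin d → ℝ} (hv : ∀ j, 0 ≤ v j)
    (hy : ∀ j k s t, inner ℂ (y j s) (y k t) = if j = k ∧ s = t then (v j : ℂ) else 0)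
    (hΘ : ∀ k i j, v j = 0 → Θ k i j = 0) :
    OnlyRemovableOnCircle (fun z => (arPoly Ψ z)⁻¹ * maPoly Θ z) := by
  rw [onlyRemovableOnCircle_iff]
  rintro i j l hl n ⟨a, ha⟩
  refine X_sub_C_pow_dvd_of_bounded_solution hl (hx i) hv hy a n (fun j => transferNum Ψ Θ i j)
    (fun j hj => ?_) ?_ j
  · simp [transferNum, Matrix.mul_apply, maPolyMatrix, Matrix.sum_apply, hΘ _ _ j hj]
  · rw [← ha, aeval_det_arPolyMatrix h, sub_self, map_zero]

end Difference

/-! ### Covariances as inner products in `L²` -/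

section RandomVectors

variable {Ω : Type*} [MeasurableSpace Ω] {μ : Measure Ω} {r k : ℕ}

lemma memLp_mulVec {X : Ω → Fin r → ℂ} (hX : MemLp X 2 μ) (A : Matrix (Fin k) (Fin r) ℂ) :
    MemLp (fun ω => A *ᵥ X ω) 2 μ := by
  refine memLp_pi_iff.2 fun i => ?_
  simp only [Matrix.mulVec, dotProduct]
  exact memLp_finsetSum _ fun j _ => (hX.eval j).const_mul _

lemma integral_mulVec {X : Ω → Fin r → ℂ} (hX : Integrable X μ) (A : Matrix (Fin k) (Fin r) ℂ) :
    ∫ ω, A *ᵥ X ω ∂μ = A *ᵥ ∫ ω, X ω ∂μ :=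
  (LinearMap.toContinuousLinearMap A.mulVecLin).integral_comp_comm hX

/-- The `i`-th coordinate of a square integrable random vector, as an element of `L²`. -/
noncomputable def coordLp {X : Ω → Fin r → ℂ} (hX : MemLp X 2 μ) (i : Fin r) : Lp ℂ 2 μ :=
  (hX.eval i).toLp

lemma coordLp_ae {X : Ω → Fin r → ℂ} (hX : MemLp X 2 μ) (i : Fin r) :
    coordLp hX i =ᵐ[μ] fun ω => X ω i := (hX.eval i).coeFn_toLp

lemma coordLp_mulVec {X : Ω → Fin r → ℂ} (hX : MemLp X 2 μ) (A : Matrix (Fin k) (Fin r) ℂ)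
    (i : Fin k) : coordLp (memLp_mulVec hX A) i = ∑ j, A i j • coordLp hX j := by
  refine Lp.ext ?_
  have h1 : ∀ᵐ ω ∂μ, ∀ j, (A i j • coordLp hX j : Lp ℂ 2 μ) ω = A i j * X ω j := by
    refine ae_all_iff.2 fun j => ?_
    filter_upwards [Lp.coeFn_smul (A i j) (coordLp hX j), coordLp_ae hX j] with ω h1 h2
    rw [h1, Pi.smul_apply, h2, smul_eq_mul]
  filter_upwards [coordLp_ae (memLp_mulVec hX A) i,
    Lp.coeFn_fun_finsetSum Finset.univ fun j => A i j • coordLp hX j, h1] with ω h2 h3 h4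
  rw [h2, h3]
  simp only [h4, Matrix.mulVec, dotProduct]

lemma inner_coordLp {X : Ω → Fin r → ℂ} {Y : Ω → Fin k → ℂ} (hX : MemLp X 2 μ)
    (hY : MemLp Y 2 μ) (i : Fin r) (j : Fin k) :
    inner ℂ (coordLp hY j) (coordLp hX i) = ∫ ω, X ω i * star (Y ω j) ∂μ := by
  rw [L2.inner_def]
  refine integral_congr_ae ?_
  filter_upwards [coordLp_ae hX i, coordLp_ae hY j] with ω h1 h2
  rw [h1, h2]
  simp

variable [IsProbabilityMeasure μ]

lemma integral_apply {X : Ω → Fin r → ℂ} (hX : MemLp X 2 μ) (i : Fin r) :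
    ∫ ω, X ω i ∂μ = (∫ ω, X ω ∂μ) i :=
  (eval_integral (fun i => (hX.eval i).integrable one_le_two) i).symm

/-- The arguments are swapped because the inner product is conjugate-linear in the first one. -/
lemma covMatrix_eq_inner {X : Ω → Fin r → ℂ} {Y : Ω → Fin k → ℂ} (hX : MemLp X 2 μ)
    (hY : MemLp Y 2 μ) (hX0 : ∫ ω, X ω ∂μ = 0) (hY0 : ∫ ω, Y ω ∂μ = 0) (i : Fin r) (j : Fin k) :
    covMatrix μ X Y i j = inner ℂ (coordLp hY j) (coordLp hX i) := by
  rw [inner_coordLp, covMatrix, Matrix.of_apply, integral_apply hX, integral_apply hY, hX0, hY0]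
  simp

lemma covMatrix_add_const {X : Ω → Fin r → ℂ} {Y : Ω → Fin k → ℂ} (hX : MemLp X 2 μ)
    (hY : MemLp Y 2 μ) (a : Fin r → ℂ) (b : Fin k → ℂ) :
    covMatrix μ (fun ω => a + X ω) (fun ω => b + Y ω) = covMatrix μ X Y := by
  have h : ∀ {n : ℕ} {W : Ω → Fin n → ℂ} (_ : MemLp W 2 μ) (c : Fin n → ℂ) (i : Fin n),
      ∫ ω, (c i + W ω i) ∂μ = c i + ∫ ω, W ω i ∂μ := fun hW c i => by
    rw [integral_add (integrable_const _) ((hW.eval i).integrable one_le_two)]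
    simp
  ext i j
  simp only [covMatrix, Matrix.of_apply, Pi.add_apply, h hX, h hY, add_sub_add_left_eq_sub]

lemma covMatrix_mulVec {X : Ω → Fin r → ℂ} {Y : Ω → Fin k → ℂ} (hX : MemLp X 2 μ)
    (hY : MemLp Y 2 μ) (hX0 : ∫ ω, X ω ∂μ = 0) (hY0 : ∫ ω, Y ω ∂μ = 0) {r' k' : ℕ}
    (A : Matrix (Fin r') (Fin r) ℂ) (B : Matrix (Fin k') (Fin k) ℂ) :
    covMatrix μ (fun ω => A *ᵥ X ω) (fun ω => B *ᵥ Y ω) = A * covMatrix μ X Y * Bᴴ := by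
  have hAX : ∫ ω, A *ᵥ X ω ∂μ = 0 := by
    rw [integral_mulVec (hX.integrable one_le_two), hX0, Matrix.mulVec_zero]
  have hBY : ∫ ω, B *ᵥ Y ω ∂μ = 0 := by
    rw [integral_mulVec (hY.integrable one_le_two), hY0, Matrix.mulVec_zero]
  ext i j
  rw [covMatrix_eq_inner (memLp_mulVec hX A) (memLp_mulVec hY B) hAX hBY,
    coordLp_mulVec hX, coordLp_mulVec hY, sum_inner]
  simp only [inner_sum, inner_smul_left, inner_smul_right, ← covMatrix_eq_inner hX hY hX0 hY0,
    Matrix.mul_apply, Matrix.conjTranspose_apply, Finset.sum_mul]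
  refine Finset.sum_congr rfl fun l _ => Finset.sum_congr rfl fun n _ => ?_
  simp only [starRingEnd_apply]
  ring

open scoped ComplexOrder in
lemma posSemidef_covMatrix {X : Ω → Fin r → ℂ} (hX : MemLp X 2 μ) (hX0 : ∫ ω, X ω ∂μ = 0) :
    (covMatrix μ X X).PosSemidef := by
  have h : covMatrix μ X X = (Matrix.gram ℂ (coordLp hX))ᵀ := by
    ext i j
    rw [covMatrix_eq_inner hX hX hX0 hX0, Matrix.transpose_apply, Matrix.gram_apply]
  rw [h]
  exact (Matrix.posSemidef_gram ℂ _).transpose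

lemma IsWeaklyStationary.add_const {X : ℤ → Ω → Fin r → ℂ} (hX : IsWeaklyStationary μ X)
    (a : Fin r → ℂ) : IsWeaklyStationary μ (fun t ω => a + X t ω) where
  memLp t := (memLp_const a).add (hX.memLp t)
  mean_eq t t' := by
    rw [integral_add (integrable_const _) ((hX.memLp t).integrable one_le_two),
      integral_add (integrable_const _) ((hX.memLp t').integrable one_le_two), hX.mean_eq t t']
  cov_eq h t t' := by
    rw [covMatrix_add_const (hX.memLp _) (hX.memLp _),
      covMatrix_add_const (hX.memLp _) (hX.memLp _), hX.cov_eq h t t']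

/-- The centered process. -/
lemma IsWeaklyStationary.sub_mean {X : ℤ → Ω → Fin r → ℂ} (hX : IsWeaklyStationary μ X) :
    IsWeaklyStationary μ (fun t ω => X t ω - ∫ ω', X 0 ω' ∂μ) ∧
      ∀ t, ∫ ω, (X t ω - ∫ ω', X 0 ω' ∂μ) ∂μ = 0 := by
  constructor
  · simpa only [sub_eq_neg_add] using hX.add_const (-∫ ω', X 0 ω' ∂μ)
  · intro t
    rw [integral_sub ((hX.memLp t).integrable one_le_two) (integrable_const _), hX.mean_eq t 0]
    simp

/-- The squared norms are diagonal entries of the covariance at lag zero. This supplies the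
boundedness for necessity and the domination for linear filters. -/
lemma IsWeaklyStationary.norm_coordLp_eq {X : ℤ → Ω → Fin r → ℂ} (hX : IsWeaklyStationary μ X)
    (hX0 : ∀ t, ∫ ω, X t ω ∂μ = 0) (i : Fin r) (t t' : ℤ) :
    ‖coordLp (hX.memLp t) i‖ = ‖coordLp (hX.memLp t') i‖ := by
  have h := congrFun (congrFun (hX.cov_eq 0 t t') i) i
  simp only [add_zero] at h
  rw [covMatrix_eq_inner (hX.memLp t) (hX.memLp t) (hX0 t) (hX0 t),
    covMatrix_eq_inner (hX.memLp t') (hX.memLp t') (hX0 t') (hX0 t')] at h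
  rw [norm_eq_sqrt_re_inner (𝕜 := ℂ), norm_eq_sqrt_re_inner (𝕜 := ℂ), h]

end RandomVectors

/-! ### Unitary diagonalization with the positive eigenvalues first -/

lemma Antitone.pos_iff_lt_card {d : ℕ} {f : Fin d → ℝ} (hf : Antitone f) (i : Fin d) :
    0 < f i ↔ i.val < (Finset.univ.filter fun j => 0 < f j).card := by
  constructor
  · intro hi
    have h1 : Finset.Iic i ⊆ Finset.univ.filter fun j => 0 < f j := fun j hj =>
      Finset.mem_filter.2 ⟨Finset.mem_univ _, hi.trans_le (hf (Finset.mem_Iic.1 hj))⟩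
    have h2 := Finset.card_le_card h1
    rw [Fin.card_Iic] at h2
    omega
  · intro hi
    by_contra h0
    have h1 : (Finset.univ.filter fun j => 0 < f j) ⊆ Finset.Iio i := fun j hj => by
      rw [Finset.mem_Iio]
      by_contra hji
      exact h0 ((Finset.mem_filter.1 hj).2.trans_le (hf (not_lt.1 hji)))
    have h2 := Finset.card_le_card h1
    rw [Fin.card_Iio] at h2
    omega

open scoped ComplexOrder in
/-- A positive semidefinite matrix can be diagonalized with its positive eigenvalues first. -/
theorem exists_isUnitaryDiagonalization {d : ℕ} {S : Matrix (Fin d) (Fin d) ℂ}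
    (hS : S.PosSemidef) :
    ∃ (s : ℕ) (D : Fin s → ℝ) (U : Matrix (Fin d) (Fin d) ℂ),
      IsUnitaryDiagonalization S s D U := by
  set V : Matrix (Fin d) (Fin d) ℂ := hS.1.eigenvectorUnitary.1
  have hVV : Vᴴ * V = 1 := (Matrix.mem_unitaryGroup_iff').1 hS.1.eigenvectorUnitary.2
  have hdiag : Vᴴ * S * V = Matrix.diagonal fun i => (hS.1.eigenvalues i : ℂ) := by
    have h := hS.1.spectral_theorem
    rw [Unitary.conjStarAlgAut_apply] at h
    change S = V * _ * Vᴴ at h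
    refine (congrArg (fun M => Vᴴ * M * V) h).trans ?_
    rw [← Matrix.mul_assoc, ← Matrix.mul_assoc, hVV, Matrix.one_mul, Matrix.mul_assoc, hVV,
      Matrix.mul_one]
    rfl
  -- Sorting the negated eigenvalues in increasing order lists the eigenvalues in decreasing order.
  set σ : Equiv.Perm (Fin d) := Tuple.sort fun i => -hS.1.eigenvalues i
  set f : Fin d → ℝ := fun i => hS.1.eigenvalues (σ i) with hf
  have hfa : Antitone f := fun i j hij =>
    neg_le_neg_iff.1 (Tuple.monotone_sort (fun i => -hS.1.eigenvalues i) hij)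
  set s := (Finset.univ.filter fun j => 0 < f j).card with hs
  have hsd : s ≤ d := (Finset.card_le_univ _).trans_eq (Fintype.card_fin d)
  refine ⟨s, fun i => f ⟨i, i.2.trans_le hsd⟩, Vᴴ.submatrix σ id, hsd, ?_, fun i => ?_, ?_⟩
  · rw [Matrix.mem_unitaryGroup_iff, Matrix.star_eq_conjTranspose, Matrix.conjTranspose_submatrix,
      Matrix.conjTranspose_conjTranspose, ← Matrix.submatrix_mul _ _ _ _ _ Function.bijective_id,
      hVV, Matrix.submatrix_one_equiv]
  · exact (Antitone.pos_iff_lt_card hfa _).2 i.2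
  · have h1 : Vᴴ.submatrix σ id * S * (Vᴴ.submatrix σ id)ᴴ = (Vᴴ * S * V).submatrix σ σ := by
      rw [Matrix.conjTranspose_submatrix, Matrix.conjTranspose_conjTranspose]
      ext i j
      simp [Matrix.mul_apply]
    rw [h1, hdiag, Matrix.submatrix_diagonal _ _ σ.injective, padDiag]
    congr 1
    ext i
    simp only [Function.comp_apply]
    split_ifs with hi
    · rfl
    · have h2 : ¬ 0 < f i := fun h0 => hi ((Antitone.pos_iff_lt_card hfa i).1 h0)
      have h3 : f i = 0 := le_antisymm (not_lt.1 h2) (hS.eigenvalues_nonneg _)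
      exact_mod_cast h3

/-! ### Linear filters of weakly stationary processes -/

section Series

variable {Ω : Type*} [MeasurableSpace Ω] {μ : Measure Ω}

/-- An absolutely convergent series in `L²` converges absolutely almost surely, to its sum in
`L²`, and may be integrated term by term. -/
lemma hasSum_toLp_tsum {f : ℤ → Ω → ℂ} (hf : ∀ j, MemLp (f j) 2 μ)
    (hs : Summable fun j => ‖(hf j).toLp‖) :
    (∀ᵐ ω ∂μ, Summable fun j => ‖f j ω‖) ∧
      ∃ h : MemLp (fun ω => ∑' j, f j ω) 2 μ, HasSum (fun j => (hf j).toLp) h.toLp := by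
  have hs' : ∑' j, ‖(hf j).toLp‖ₑ ≠ ⊤ := tsum_enorm_ne_top_iff_summable_norm.2 hs
  constructor
  · refine summable_norm_of_tsum_eLpNorm_ne_top one_le_two (fun j => (hf j).1) ?_
    simpa only [Lp.enorm_toLp] using hs'
  · have hae : (∑' j, (hf j).toLp : Lp ℂ 2 μ) =ᵐ[μ] fun ω => ∑' j, f j ω := by
      filter_upwards [Lp.coeFn_tsum hs', ae_all_iff.2 fun j => (hf j).coeFn_toLp] with ω h1 h2
      rw [h1]
      exact tsum_congr h2
    have h : MemLp (fun ω => ∑' j, f j ω) 2 μ := (memLp_congr_ae hae).1 (Lp.memLp _)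
    refine ⟨h, ?_⟩
    have e : h.toLp = ∑' j, (hf j).toLp := Lp.ext (h.coeFn_toLp.trans hae.symm)
    rw [e]
    exact hs.of_norm.hasSum

variable [IsProbabilityMeasure μ]

/-- Writing the expectation as an inner product makes it continuous on `L²`, so it passes through
series. -/
lemma inner_one_toLp {f : Ω → ℂ} (hf : MemLp f 2 μ) :
    inner ℂ (memLp_const (1 : ℂ) : MemLp (fun _ : Ω => (1 : ℂ)) 2 μ).toLp hf.toLp =
      ∫ ω, f ω ∂μ := by
  rw [L2.inner_def]
  refine integral_congr_ae ?_
  filter_upwards [(memLp_const (1 : ℂ) : MemLp (fun _ : Ω => (1 : ℂ)) 2 μ).coeFn_toLp,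
    hf.coeFn_toLp] with ω h1 h2
  rw [h1, h2]
  simp

/-- Continuity in each argument separately suffices; no double series has to be summed. -/
lemma inner_eq_inner_of_hasSum {H ι κ : Type*} [NormedAddCommGroup H] [InnerProductSpace ℂ H]
    {f f' : ι → H} {g g' : κ → H} {x x' y y' : H} (hf : HasSum f x) (hf' : HasSum f' x')
    (hg : HasSum g y) (hg' : HasSum g' y') (h : ∀ i j, inner ℂ (f i) (g j) = inner ℂ (f' i) (g' j)) :
    inner ℂ x y = inner ℂ x' y' := by
  have h1 : ∀ i, inner ℂ (f i) y = inner ℂ (f' i) y' := fun i => by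
    have a := hg.mapL (innerSL ℂ (f i))
    have b := hg'.mapL (innerSL ℂ (f' i))
    simp only [innerSL_apply_apply] at a b
    exact a.unique (b.congr_fun fun j => h i j)
  have h2 : inner ℂ y x = inner ℂ y' x' := by
    have a := hf.mapL (innerSL ℂ y)
    have b := hf'.mapL (innerSL ℂ y')
    simp only [innerSL_apply_apply] at a b
    refine a.unique (b.congr_fun fun j => ?_)
    rw [← inner_conj_symm, h1, inner_conj_symm]
  rw [← inner_conj_symm, h2, inner_conj_symm]

variable {m d : ℕ}

/-- An absolutely summable linear filter of a centered weakly stationary process converges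
absolutely almost surely, and its output is weakly stationary. -/
theorem IsWeaklyStationary.linearFilter {N : ℤ → Ω → Fin d → ℂ} (hN : IsWeaklyStationary μ N)
    (hN0 : ∀ t, ∫ ω, N t ω ∂μ = 0) {A : ℤ → Matrix (Fin m) (Fin d) ℂ}
    (hA : ∀ i k, Summable fun j => ‖A j i k‖) :
    (∀ᵐ ω ∂μ, ∀ t : ℤ, Summable fun j : ℤ => ‖A j *ᵥ N (t - j) ω‖) ∧
      IsWeaklyStationary μ (fun t ω => ∑' j : ℤ, A j *ᵥ N (t - j) ω) := by
  have hAN : ∀ t j, MemLp (fun ω => A j *ᵥ N (t - j) ω) 2 μ := fun t j =>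
    memLp_mulVec (hN.memLp _) _
  have hAN0 : ∀ t j, ∫ ω, A j *ᵥ N (t - j) ω ∂μ = 0 := fun t j => by
    rw [integral_mulVec ((hN.memLp _).integrable one_le_two), hN0, Matrix.mulVec_zero]
  have hsum : ∀ t i, Summable fun j => ‖((hAN t j).eval i).toLp‖ := fun t i => by
    refine Summable.of_nonneg_of_le (fun _ => norm_nonneg _) (fun j => ?_)
      (summable_sum (s := Finset.univ) fun k _ =>
        (hA i k).mul_right ‖coordLp (hN.memLp 0) k‖)
    change ‖coordLp (memLp_mulVec (hN.memLp (t - j)) (A j)) i‖ ≤ _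
    rw [coordLp_mulVec (hN.memLp (t - j))]
    refine (norm_sum_le _ _).trans (Finset.sum_le_sum fun k _ => ?_)
    rw [norm_smul, hN.norm_coordLp_eq hN0 k (t - j) 0]
  have hser := fun t i => hasSum_toLp_tsum (fun j => (hAN t j).eval i) (hsum t i)
  choose hae hmem hhas using hser
  have hae' : ∀ᵐ ω ∂μ, ∀ t : ℤ, Summable fun j : ℤ => ‖A j *ᵥ N (t - j) ω‖ := by
    filter_upwards [ae_all_iff.2 fun t => ae_all_iff.2 fun i => hae t i] with ω h t
    exact (Pi.summable.2 fun i => (h t i).of_norm).norm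
  have heq : ∀ t, (fun ω => ∑' j : ℤ, A j *ᵥ N (t - j) ω) =ᵐ[μ]
      fun ω i => ∑' j : ℤ, (A j *ᵥ N (t - j) ω) i := fun t => by
    filter_upwards [hae'] with ω h
    ext i
    exact tsum_apply (h t).of_norm
  have hYmem : ∀ t, MemLp (fun ω => ∑' j : ℤ, A j *ᵥ N (t - j) ω) 2 μ := fun t =>
    (memLp_congr_ae (heq t)).2 (memLp_pi_iff.2 fun i => hmem t i)
  have hYhas : ∀ t i, HasSum (fun j => coordLp (hAN t j) i) (coordLp (hYmem t) i) :=
    fun t i => by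
    have e : coordLp (hYmem t) i = (hmem t i).toLp := by
      refine (MemLp.toLp_eq_toLp_iff _ _).2 ?_
      filter_upwards [heq t] with ω h
      rw [h]
    rw [e]
    exact hhas t i
  have hY0 : ∀ t, ∫ ω, ∑' j : ℤ, A j *ᵥ N (t - j) ω ∂μ = 0 := fun t => by
    ext i
    have h1 := (hYhas t i).mapL
      (innerSL ℂ (memLp_const (1 : ℂ) : MemLp (fun _ : Ω => (1 : ℂ)) 2 μ).toLp)
    simp only [innerSL_apply_apply, coordLp, inner_one_toLp] at h1
    rw [integral_apply (hYmem t)] at h1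
    refine h1.unique (hasSum_zero.congr_fun fun j => ?_)
    rw [integral_apply (hAN t j), hAN0, Pi.zero_apply]
  refine ⟨hae', hYmem, fun t t' => by rw [hY0, hY0], fun h t t' => ?_⟩
  ext i k
  rw [covMatrix_eq_inner (hYmem t) (hYmem (t + h)) (hY0 _) (hY0 _),
    covMatrix_eq_inner (hYmem t') (hYmem (t' + h)) (hY0 _) (hY0 _)]
  refine inner_eq_inner_of_hasSum (hYhas _ _) (hYhas _ _) (hYhas _ _) (hYhas _ _)
    fun a b => ?_
  rw [← covMatrix_eq_inner (hAN _ _) (hAN _ _) (hAN0 _ _) (hAN0 _ _),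
    ← covMatrix_eq_inner (hAN _ _) (hAN _ _) (hAN0 _ _) (hAN0 _ _),
    covMatrix_mulVec (hN.memLp _) (hN.memLp _) (hN0 _) (hN0 _),
    covMatrix_mulVec (hN.memLp _) (hN.memLp _) (hN0 _) (hN0 _)]
  -- The time lag between the two filtered terms is `h - a + b`, independent of `t`.
  have e : ∀ t : ℤ, t + h - a = (t - b) + (h - a + b) := fun t => by ring
  rw [e t, e t', hN.cov_eq (h - a + b) (t - b) (t' - b)]

end Series

/-! ### The ARMA equation along a single path -/

section Pointwise

variable {m d p q : ℕ} {Ψ : Fin p → Matrix (Fin m) (Fin m) ℂ}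
  {Θ : Fin (q + 1) → Matrix (Fin m) (Fin d) ℂ}

lemma arPoly_one_mulVec (g : Fin m → ℂ) :
    arPoly Ψ 1 *ᵥ g = g - ∑ k : Fin p, Ψ k *ᵥ g := by
  simp [arPoly, Matrix.sub_mulVec, Matrix.sum_mulVec]

lemma maPoly_one_mulVec (h : Fin d → ℂ) :
    maPoly Θ 1 *ᵥ h = ∑ k : Fin (q + 1), Θ k *ᵥ h := by
  simp [maPoly, Matrix.sum_mulVec]

/-- Centering both sides of the ARMA equation. -/
lemma arma_eq_iff_sub {g : Fin m → ℂ} {h : Fin d → ℂ} (hgh : arPoly Ψ 1 *ᵥ g = maPoly Θ 1 *ᵥ h)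
    (y : ℤ → Fin m → ℂ) (z : ℤ → Fin d → ℂ) (t : ℤ) :
    y t - ∑ k : Fin p, Ψ k *ᵥ y (t - ((k.val : ℤ) + 1)) =
        ∑ k : Fin (q + 1), Θ k *ᵥ z (t - (k.val : ℤ)) ↔
      (y t - g) - ∑ k : Fin p, Ψ k *ᵥ (y (t - ((k.val : ℤ) + 1)) - g) =
        ∑ k : Fin (q + 1), Θ k *ᵥ (z (t - (k.val : ℤ)) - h) := by
  rw [arPoly_one_mulVec, maPoly_one_mulVec] at hgh
  simp only [Matrix.mulVec_sub, Finset.sum_sub_distrib]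
  rw [← hgh, sub_sub_sub_comm, sub_left_inj]

/-- If `P(z) ∑ c_n z^n = Q(z)`, then `∑ c_n x_{t-n}` solves the ARMA equation with noise `x`. -/
lemma arma_eq_of_recursion {c : ℤ → Matrix (Fin m) (Fin d) ℂ}
    (hc : ∀ n : ℤ, c n - ∑ k : Fin p, Ψ k * c (n - ((k.val : ℤ) + 1)) =
      ∑ k : Fin (q + 1), if n = (k.val : ℤ) then Θ k else 0)
    {x : ℤ → Fin d → ℂ} (hs : ∀ t : ℤ, Summable fun j : ℤ => c j *ᵥ x (t - j)) (t : ℤ) :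
    ∑' j : ℤ, c j *ᵥ x (t - j) -
        ∑ k : Fin p, Ψ k *ᵥ ∑' j : ℤ, c j *ᵥ x (t - ((k.val : ℤ) + 1) - j) =
      ∑ k : Fin (q + 1), Θ k *ᵥ x (t - (k.val : ℤ)) := by
  have h1 : HasSum (fun n : ℤ => (c n - ∑ k : Fin p, Ψ k * c (n - ((k.val : ℤ) + 1))) *ᵥ x (t - n))
      (∑' j : ℤ, c j *ᵥ x (t - j) -
        ∑ k : Fin p, Ψ k *ᵥ ∑' j : ℤ, c j *ᵥ x (t - ((k.val : ℤ) + 1) - j)) := by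
    simp only [Matrix.sub_mulVec, Matrix.sum_mulVec]
    refine (hs t).hasSum.sub (hasSum_sum fun k _ => ?_)
    have h2 := (hs (t - ((k.val : ℤ) + 1))).hasSum.mapL
      (LinearMap.toContinuousLinearMap (Ψ k).mulVecLin)
    refine ((Equiv.subRight ((k.val : ℤ) + 1)).hasSum_iff.2 h2).congr_fun fun n => ?_
    simp only [Function.comp_apply, Equiv.subRight_apply, LinearMap.coe_toContinuousLinearMap',
      Matrix.mulVecLin_apply, Matrix.mulVec_mulVec]
    congr 2
    ring
  have h3 : HasSum (fun n : ℤ => (∑ k : Fin (q + 1), if n = (k.val : ℤ) then Θ k else 0) *ᵥ x (t - n))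
      (∑ k : Fin (q + 1), Θ k *ᵥ x (t - (k.val : ℤ))) := by
    simp only [Matrix.sum_mulVec]
    refine hasSum_sum fun k _ => ?_
    refine (hasSum_ite_eq (k.val : ℤ) (Θ k *ᵥ x (t - (k.val : ℤ)))).congr_fun fun n => ?_
    by_cases hn : n = (k.val : ℤ)
    · simp [hn]
    · simp [hn]
  simp only [hc] at h1
  exact h1.unique h3

end Pointwise

/-! ### Necessity and sufficiency for processes -/

section Processes

variable {Ω : Type*} [MeasurableSpace Ω] {μ : Measure Ω} [IsProbabilityMeasure μ] {m d p q : ℕ}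
  {Ψ : Fin p → Matrix (Fin m) (Fin m) ℂ} {Θ : Fin (q + 1) → Matrix (Fin m) (Fin d) ℂ}

lemma IsARMASolution.mean_eq {Z : ℤ → Ω → Fin d → ℂ} {Y : ℤ → Ω → Fin m → ℂ}
    (hZ : IsWeaklyStationary μ Z) (hY : IsWeaklyStationary μ Y) (h : IsARMASolution μ Ψ Θ Z Y) :
    arPoly Ψ 1 *ᵥ (∫ ω, Y 0 ω ∂μ) = maPoly Θ 1 *ᵥ (∫ ω, Z 0 ω ∂μ) := by
  have hYi : ∀ t, Integrable (Y t) μ := fun t => (hY.memLp t).integrable one_le_two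
  have hZi : ∀ t, Integrable (Z t) μ := fun t => (hZ.memLp t).integrable one_le_two
  have h1 : ∫ ω, (Y 0 ω - ∑ k : Fin p, Ψ k *ᵥ Y (0 - ((k.val : ℤ) + 1)) ω) ∂μ =
      ∫ ω, ∑ k : Fin (q + 1), Θ k *ᵥ Z (0 - (k.val : ℤ)) ω ∂μ :=
    integral_congr_ae (h.mono fun ω hω => hω 0)
  have hi : ∀ k t, Integrable (fun ω => Ψ k *ᵥ Y t ω) μ := fun k t =>
    (memLp_mulVec (hY.memLp t) _).integrable one_le_two
  have hi' : ∀ k t, Integrable (fun ω => Θ k *ᵥ Z t ω) μ := fun k t =>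
    (memLp_mulVec (hZ.memLp t) _).integrable one_le_two
  rw [integral_sub (hYi 0) (integrable_finsetSum _ fun k _ => hi k _),
    integral_finsetSum _ fun k _ => hi k _, integral_finsetSum _ fun k _ => hi' k _] at h1
  rw [arPoly_one_mulVec, maPoly_one_mulVec]
  convert h1 using 2
  · refine Finset.sum_congr rfl fun k _ => ?_
    rw [integral_mulVec (hYi _), hY.mean_eq 0]
  · rw [integral_mulVec (hZi _), hZ.mean_eq 0]

lemma IsARMASolution.onlyRemovableOnCircle {N : ℤ → Ω → Fin d → ℂ} {Y : ℤ → Ω → Fin m → ℂ}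
    (hN : ∀ t, MemLp (N t) 2 μ) (hY : IsWeaklyStationary μ Y) (hY0 : ∀ t, ∫ ω, Y t ω ∂μ = 0)
    {v : Fin d → ℝ} (hv : ∀ j, 0 ≤ v j)
    (hNv : ∀ j k s t, inner ℂ (coordLp (hN s) j) (coordLp (hN t) k) =
      if j = k ∧ s = t then (v j : ℂ) else 0)
    (hΘ : ∀ k i j, v j = 0 → Θ k i j = 0) (h : IsARMASolution μ Ψ Θ N Y) :
    OnlyRemovableOnCircle (fun z => (arPoly Ψ z)⁻¹ * maPoly Θ z) := by
  refine onlyRemovableOnCircle_of_bounded (H := Lp ℂ 2 μ)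
    (x := fun i t => coordLp (hY.memLp t) i) (y := fun j t => coordLp (hN t) j) (fun t i => ?_)
    (fun i => ⟨_, fun t => (hY.norm_coordLp_eq hY0 i t 0).le⟩) hv hNv hΘ
  simp only [← coordLp_mulVec]
  refine Lp.ext ?_
  set u : Fin p → Lp ℂ 2 μ := fun k =>
    coordLp (memLp_mulVec (hY.memLp (t - ((k.val : ℤ) + 1))) (Ψ k)) i
  set w : Fin (q + 1) → Lp ℂ 2 μ := fun k =>
    coordLp (memLp_mulVec (hN (t - (k.val : ℤ))) (Θ k)) i
  have e6 : ∀ᵐ ω ∂μ, ∀ k, u k ω = (Ψ k *ᵥ Y (t - ((k.val : ℤ) + 1)) ω) i :=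
    ae_all_iff.2 fun k => coordLp_ae (memLp_mulVec (hY.memLp _) (Ψ k)) i
  have e7 : ∀ᵐ ω ∂μ, ∀ k, w k ω = (Θ k *ᵥ N (t - (k.val : ℤ)) ω) i :=
    ae_all_iff.2 fun k => coordLp_ae (memLp_mulVec (hN _) (Θ k)) i
  filter_upwards [h, Lp.coeFn_sub (coordLp (hY.memLp t) i) (∑ k, u k),
    Lp.coeFn_fun_finsetSum Finset.univ u, Lp.coeFn_fun_finsetSum Finset.univ w,
    coordLp_ae (hY.memLp t) i, e6, e7] with ω h1 h2 h3 h4 h5 h6 h7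
  rw [h2, Pi.sub_apply, h3, h4, h5]
  simp only [h6, h7]
  have := congrFun (h1 t) i
  simpa only [Pi.sub_apply, Finset.sum_apply] using this

lemma IsWeaklyStationary.mulVec {X : ℤ → Ω → Fin d → ℂ} (hX : IsWeaklyStationary μ X)
    (hX0 : ∀ t, ∫ ω, X t ω ∂μ = 0) (A : Matrix (Fin m) (Fin d) ℂ) :
    IsWeaklyStationary μ (fun t ω => A *ᵥ X t ω) ∧ ∀ t, ∫ ω, A *ᵥ X t ω ∂μ = 0 := by
  have h0 : ∀ t, ∫ ω, A *ᵥ X t ω ∂μ = 0 := fun t => by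
    rw [integral_mulVec ((hX.memLp t).integrable one_le_two), hX0, Matrix.mulVec_zero]
  refine ⟨⟨fun t => memLp_mulVec (hX.memLp t) A, fun t t' => by rw [h0, h0], fun h t t' => ?_⟩, h0⟩
  rw [covMatrix_mulVec (hX.memLp _) (hX.memLp _) (hX0 _) (hX0 _),
    covMatrix_mulVec (hX.memLp _) (hX.memLp _) (hX0 _) (hX0 _), hX.cov_eq h t t']

/-- The variances of the components of `U (Z_t - E Z_0)`. -/
noncomputable def padVar (d : ℕ) {s : ℕ} (D : Fin s → ℝ) (i : Fin d) : ℝ :=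
  if h : i.val < s then D ⟨i.val, h⟩ else 0

variable {Z : ℤ → Ω → Fin d → ℂ} {s : ℕ} {D : Fin s → ℝ} {U : Matrix (Fin d) (Fin d) ℂ}

/-- The components of `U (Z_t - E Z_0)` are orthogonal white noises. -/
lemma IsWeakWhiteNoise.covMatrix_mulVec (hZ : IsWeakWhiteNoise μ Z)
    (hU : IsUnitaryDiagonalization (covMatrix μ (Z 0) (Z 0)) s D U) (t t' : ℤ) (i j : Fin d) :
    covMatrix μ (fun ω => U *ᵥ (Z t ω - ∫ ω', Z 0 ω' ∂μ))
        (fun ω => U *ᵥ (Z t' ω - ∫ ω', Z 0 ω' ∂μ)) i j =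
      if i = j ∧ t = t' then (padVar d D i : ℂ) else 0 := by
  obtain ⟨hZs, hZ0⟩ := hZ.toIsWeaklyStationary.sub_mean
  rw [WeakARMA.covMatrix_mulVec (hZs.memLp t) (hZs.memLp t') (hZ0 t) (hZ0 t')]
  have h1 : covMatrix μ (fun ω => Z t ω - ∫ ω', Z 0 ω' ∂μ) (fun ω => Z t' ω - ∫ ω', Z 0 ω' ∂μ) =
      covMatrix μ (Z t) (Z t') := by
    simp only [sub_eq_neg_add]
    exact covMatrix_add_const (hZ.memLp t) (hZ.memLp t') _ _
  rw [h1]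
  by_cases ht : t = t'
  · subst ht
    have h2 := hZ.cov_eq 0 t 0
    simp only [add_zero] at h2
    rw [h2, hU.diag, padDiag, Matrix.diagonal_apply]
    simp only [and_true, padVar]
    split_ifs <;> simp
  · rw [hZ.uncorrelated t t' ht]
    simp [ht]

/-- The components of `U (Z_t - E Z_0)` beyond the first `s` vanish almost surely. -/
lemma IsWeakWhiteNoise.padDiag_mulVec_ae (hZ : IsWeakWhiteNoise μ Z)
    (hU : IsUnitaryDiagonalization (covMatrix μ (Z 0) (Z 0)) s D U) :
    ∀ᵐ ω ∂μ, ∀ t : ℤ, padDiag d (fun _ : Fin s => (1 : ℂ)) *ᵥ (U *ᵥ (Z t ω - ∫ ω', Z 0 ω' ∂μ)) =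
      U *ᵥ (Z t ω - ∫ ω', Z 0 ω' ∂μ) := by
  obtain ⟨hZs, hZ0⟩ := hZ.toIsWeaklyStationary.sub_mean
  obtain ⟨hN, hN0⟩ := hZs.mulVec hZ0 U
  have h1 : ∀ (t : ℤ) (i : Fin d), ∀ᵐ ω ∂μ, ¬ i.val < s →
      (U *ᵥ (Z t ω - ∫ ω', Z 0 ω' ∂μ)) i = 0 := fun t i => by
    by_cases hi : i.val < s
    · exact ae_of_all _ fun ω h => absurd hi h
    have h2 := hZ.covMatrix_mulVec hU t t i i
    rw [covMatrix_eq_inner (hN.memLp t) (hN.memLp t) (hN0 t) (hN0 t), if_pos ⟨rfl, rfl⟩, padVar,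
      dif_neg hi, Complex.ofReal_zero, inner_self_eq_zero] at h2
    have h3 := coordLp_ae (hN.memLp t) i
    rw [h2] at h3
    filter_upwards [h3, Lp.coeFn_zero ℂ 2 μ] with ω h4 h5 _
    rw [← h4, h5, Pi.zero_apply]
  filter_upwards [ae_all_iff.2 fun t => ae_all_iff.2 fun i => h1 t i] with ω h t
  ext i
  rw [padDiag, Matrix.mulVec_diagonal]
  split_ifs with hi
  · rw [one_mul]
  · rw [zero_mul, h t i hi]

/-- The cut-off `diag(Id_s, 0)` removes only components that are already zero almost surely, and
then `U^* U = Id`. -/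
lemma IsWeakWhiteNoise.whitened_ae (hZ : IsWeakWhiteNoise μ Z)
    (hU : IsUnitaryDiagonalization (covMatrix μ (Z 0) (Z 0)) s D U) :
    ∀ᵐ ω ∂μ, ∀ (t : ℤ) (k : Fin (q + 1)),
      (Θ k * (Uᴴ * padDiag d (fun _ : Fin s => (1 : ℂ)))) *ᵥ (U *ᵥ (Z t ω - ∫ ω', Z 0 ω' ∂μ)) =
        Θ k *ᵥ (Z t ω - ∫ ω', Z 0 ω' ∂μ) := by
  filter_upwards [hZ.padDiag_mulVec_ae hU] with ω h t k
  rw [← Matrix.mulVec_mulVec, ← Matrix.mulVec_mulVec _ Uᴴ, h t, Matrix.mulVec_mulVec _ Uᴴ,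
    ← Matrix.star_eq_conjTranspose, (Matrix.mem_unitaryGroup_iff').1 hU.unitary, Matrix.one_mulVec]

theorem IsARMASolution.onlyRemovableOnCircle_transfer (hZ : IsWeakWhiteNoise μ Z)
    (hU : IsUnitaryDiagonalization (covMatrix μ (Z 0) (Z 0)) s D U) {Y : ℤ → Ω → Fin m → ℂ}
    (hY : IsWeaklyStationary μ Y) (h : IsARMASolution μ Ψ Θ Z Y) :
    OnlyRemovableOnCircle (transfer Ψ Θ U s) := by
  rw [funext (transfer_eq Ψ Θ U s)]
  obtain ⟨hZs, hZ0⟩ := hZ.toIsWeaklyStationary.sub_mean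
  obtain ⟨hN, hN0⟩ := hZs.mulVec hZ0 U
  obtain ⟨hYs, hY0⟩ := hY.sub_mean
  have hmean := h.mean_eq hZ.toIsWeaklyStationary hY
  refine IsARMASolution.onlyRemovableOnCircle hN.memLp hYs hY0 (v := padVar d D)
    (fun j => ?_) (fun j k t t' => ?_) (fun k i j hj => ?_) ?_
  · rw [padVar]
    split_ifs with hj
    · exact (hU.pos _).le
    · exact le_rfl
  · rw [← covMatrix_eq_inner (hN.memLp _) (hN.memLp _) (hN0 _) (hN0 _),
      hZ.covMatrix_mulVec hU]
    by_cases hjk : j = k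
    · subst hjk
      simp [eq_comm]
    · simp [hjk, Ne.symm hjk]
  · have hjs : ¬ j.val < s := fun hjs => by
      rw [padVar, dif_pos hjs] at hj
      exact (hU.pos _).ne' hj
    rw [← Matrix.mul_assoc, padDiag, Matrix.mul_diagonal, dif_neg hjs, mul_zero]
  · filter_upwards [h, hZ.whitened_ae (Θ := Θ) hU] with ω h1 h2 t
    rw [(arma_eq_iff_sub hmean (fun t => Y t ω) (fun t => Z t ω) t).1 (h1 t)]
    exact Finset.sum_congr rfl fun k _ => (h2 _ k).symm

theorem IsLaurentExpansion.solution (hZ : IsWeakWhiteNoise μ Z)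
    (hU : IsUnitaryDiagonalization (covMatrix μ (Z 0) (Z 0)) s D U)
    {c : ℤ → Matrix (Fin m) (Fin d) ℂ} (hc : IsLaurentExpansion Ψ Θ U s c) {g : Fin m → ℂ}
    (hg : arPoly Ψ 1 *ᵥ g = maPoly Θ 1 *ᵥ (∫ ω, Z 0 ω ∂μ)) :
    (∀ᵐ ω ∂μ, ∀ t : ℤ, Summable fun j : ℤ =>
      ‖c j *ᵥ (U *ᵥ (Z (t - j) ω - ∫ ω', Z 0 ω' ∂μ))‖) ∧
    IsWeaklyStationary μ
      (fun t ω => g + ∑' j : ℤ, c j *ᵥ (U *ᵥ (Z (t - j) ω - ∫ ω', Z 0 ω' ∂μ))) ∧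
    IsARMASolution μ Ψ Θ Z
      (fun t ω => g + ∑' j : ℤ, c j *ᵥ (U *ᵥ (Z (t - j) ω - ∫ ω', Z 0 ω' ∂μ))) := by
  obtain ⟨hZs, hZ0⟩ := hZ.toIsWeaklyStationary.sub_mean
  obtain ⟨hN, hN0⟩ := hZs.mulVec hZ0 U
  obtain ⟨hsum, hstat⟩ := hN.linearFilter hN0 hc.summable_norm
  refine ⟨hsum, hstat.add_const g, ?_⟩
  filter_upwards [hsum, hZ.whitened_ae (Θ := Θ) hU] with ω h1 h2 t
  refine (arma_eq_iff_sub hg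
    (fun t => g + ∑' j : ℤ, c j *ᵥ (U *ᵥ (Z (t - j) ω - ∫ ω', Z 0 ω' ∂μ)))
    (fun t => Z t ω) t).2 ?_
  simp only [add_sub_cancel_left]
  rw [arma_eq_of_recursion hc.recursion
    (x := fun t => U *ᵥ (Z t ω - ∫ ω', Z 0 ω' ∂μ)) (fun t => (h1 t).of_norm) t]
  exact Finset.sum_congr rfl fun k _ => h2 _ k

end Processes

end WeakARMA

theorem theorem3 {Ω : Type*} [MeasurableSpace Ω] (μ : Measure Ω) [IsProbabilityMeasure μ]
    {m d p q : ℕ} (Z : ℤ → Ω → Fin d → ℂ) (hZ : WeakARMA.IsWeakWhiteNoise μ Z)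
    (Ψ : Fin p → Matrix (Fin m) (Fin m) ℂ) (Θ : Fin (q + 1) → Matrix (Fin m) (Fin d) ℂ) :
    -- a diagonalizing unitary matrix exists
    (∃ (s : ℕ) (D : Fin s → ℝ) (U : Matrix (Fin d) (Fin d) ℂ),
      WeakARMA.IsUnitaryDiagonalization (WeakARMA.covMatrix μ (Z 0) (Z 0)) s D U) ∧
    ∀ (s : ℕ) (D : Fin s → ℝ) (U : Matrix (Fin d) (Fin d) ℂ),
      WeakARMA.IsUnitaryDiagonalization (WeakARMA.covMatrix μ (Z 0) (Z 0)) s D U →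
      -- the characterization of existence
      ((∃ Y : ℤ → Ω → Fin m → ℂ,
          WeakARMA.IsWeaklyStationary μ Y ∧ WeakARMA.IsARMASolution μ Ψ Θ Z Y) ↔
        (WeakARMA.OnlyRemovableOnCircle (WeakARMA.transfer Ψ Θ U s) ∧
          ∃ g : Fin m → ℂ,
            WeakARMA.arPoly Ψ 1 *ᵥ g = WeakARMA.maPoly Θ 1 *ᵥ (∫ ω, Z 0 ω ∂μ))) ∧
      -- the explicit solution
      (WeakARMA.OnlyRemovableOnCircle (WeakARMA.transfer Ψ Θ U s) →
        (∃ c : ℤ → Matrix (Fin m) (Fin d) ℂ, WeakARMA.IsLaurentExpansion Ψ Θ U s c) ∧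
        ∀ c : ℤ → Matrix (Fin m) (Fin d) ℂ, WeakARMA.IsLaurentExpansion Ψ Θ U s c →
        ∀ g : Fin m → ℂ,
          WeakARMA.arPoly Ψ 1 *ᵥ g = WeakARMA.maPoly Θ 1 *ᵥ (∫ ω, Z 0 ω ∂μ) →
          (∀ᵐ ω ∂μ, ∀ t : ℤ, Summable fun j : ℤ =>
            ‖c j *ᵥ (U *ᵥ (Z (t - j) ω - ∫ ω', Z 0 ω' ∂μ))‖) ∧
          WeakARMA.IsWeaklyStationary μ
            (fun t ω => g + ∑' j : ℤ, c j *ᵥ (U *ᵥ (Z (t - j) ω - ∫ ω', Z 0 ω' ∂μ))) ∧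
          WeakARMA.IsARMASolution μ Ψ Θ Z
            (fun t ω => g + ∑' j : ℤ, c j *ᵥ (U *ᵥ (Z (t - j) ω - ∫ ω', Z 0 ω' ∂μ)))) := by
  refine ⟨?_, fun s D U hU => ⟨⟨?_, ?_⟩, fun hrem => ?_⟩⟩
  · obtain ⟨hZs, hZ0⟩ := hZ.toIsWeaklyStationary.sub_mean
    -- Centring leaves the covariance unchanged and exhibits it as a transposed Gram matrix, hence
    -- positive semidefinite.
    have h1 := WeakARMA.posSemidef_covMatrix (hZs.memLp 0) (hZ0 0)
    simp only [sub_eq_neg_add] at h1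
    rw [WeakARMA.covMatrix_add_const (hZ.memLp 0) (hZ.memLp 0)] at h1
    exact WeakARMA.exists_isUnitaryDiagonalization h1
  · rintro ⟨Y, hY, hsol⟩
    exact ⟨hsol.onlyRemovableOnCircle_transfer hZ hU hY,
      _, hsol.mean_eq hZ.toIsWeaklyStationary hY⟩
  · rintro ⟨hrem, g, hg⟩
    obtain ⟨c, hc⟩ := WeakARMA.exists_isLaurentExpansion Ψ Θ U s hrem
    obtain ⟨-, hstat, hsol⟩ := hc.solution hZ hU hg
    exact ⟨_, hstat, hsol⟩
  · exact ⟨WeakARMA.exists_isLaurentExpansion Ψ Θ U s hrem,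
      fun c hc g hg => hc.solution hZ hU hg⟩
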